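/- **Theorem 1.** Let $\alpha\in(0,1)$, $T>0$, and let $\Omega\subset\mathbb R^d$ be open (for example a bounded Lipschitz domain, $d\in\{1,2,3\}$). Write $\langle\cdot,\cdot\rangle$ and $\|\cdot\|$ for the inner product and the norm of $L_2(\Omega)$, and let $\mathcal L v=-\operatorname{div}(A\nabla v+v\,p)+q\cdot\nabla v+c\,v$ be a linear second-order uniformly elliptic operator on $\Omega$ with bounded measurable coefficients $A,p,q,c$ depending on $x$ only, so that $$\langle\mathcal L v,w\rangle=\int_\Omega\bigl(A\nabla v\cdot\nabla w+v\,p\cdot\nabla w+(q\cdot\nabla v)\,w+c\,v\,w\bigr)\,dx\qquad\text{for } v,w\in H_0^1(\Omega).$$ Suppose that for some $\lambda\in\mathbb R$ one has $\langle\mathcal L v,v\rangle\ge\lambda\|v\|^2$ for all $v\in H_0^1(\Omega)$. For $t>0$ let $D_t^\alpha v=J_t^{1-\alpha}(\partial_t v)$ be the Caputo derivative, where $J_t^{1-\alpha}v(t)=\frac1{\Gamma(1-\alpha)}\int_0^t(t-s)^{-\alpha}v(s)\,ds$. For functions $v$ for which $\partial_t v$ need not be integrable at $t=0$, or which may be discontinuous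 at $t=0$, it is understood in the integrated-by-parts form $$\Gamma(1-\alpha)\,D_t^\alpha v(t)=t^{-\alpha}\{v(t)-v(0)\}+\int_0^t\alpha(t-s)^{-\alpha-1}\{v(t)-v(s)\}\,ds .$$ Let $f(\cdot,t)$ be locally integrable in $\Omega$ for each $t\in(0,T]$, let $u_0\in L_2(\Omega)$, and let $u$ be a solution of $$D_t^\alpha u+\mathcal L u=f\ \text{ in }\Omega\times(0,T],\qquad u(\cdot,0)=u_0\ \text{ in }\Omega,\qquad u=0\ \text{ on }\partial\Omega\ \text{ for } t>0,$$ where for each $t\in(0,T]$ the equation holds in the sense of distributions in $\Omega$. Suppose that $u$ and its approximation $u_h$ are in $L_\infty(0,t;L_2(\Omega))\cap W^{1,\infty}(\epsilon,t;L_2(\Omega))$ for any $0<\epsilon<t\le T$, and also in $H_0^1(\Omega)$ for any $t\in(0,T]$, that $u_h(\cdot,0)=u_0$, and that for each $t\in(0,T]$ the residual $R_h(\cdot,t):=(D_t^\alpha+\mathcal L)u_h(\cdot,t)-f(\cdot,t)$ is in $L_2(\Omega)$. Then $$\|(u_h-u)(\cdot,t)\|\le(D_t^\alpha+\lambda)^{-1}\|R_h(\cdot,t)\|\qquad\text{for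 all } t\in(0,T],$$ where $$(D_t^\alpha+\lambda)^{-1}v(t):=\int_0^t(t-s)^{\alpha-1}E_{\alpha,\alpha}\bigl(-\lambda(t-s)^\alpha\bigr)\,v(s)\,ds,\qquad E_{\alpha,\beta}(z)=\sum_{k=0}^\infty\frac{z^k}{\Gamma(\alpha k+\beta)},$$ and the right-hand side is $+\infty$ if this integral, whose integrand is nonnegative, diverges. -/

import Mathlib

open MeasureTheory Set
open scoped ENNReal ContDiff

noncomputable section

/-! ### The time-fractional operators -/

/-- Riemann–Liouville fractional integral
`J^β v (t) = Γ(β)⁻¹ ∫₀ᵗ (t - s)^(β - 1) v(s) ds`. -/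
def fracInt {X : Type*} [NormedAddCommGroup X] [NormedSpace ℝ X]
    (β : ℝ) (v : ℝ → X) (t : ℝ) : X :=
  (Real.Gamma β)⁻¹ • ∫ s in (0 : ℝ)..t, (t - s) ^ (β - 1) • v s

/-- Caputo derivative of order `α ∈ (0,1)` at time `t > 0`, in the integrated-by-parts form
`Γ(1-α) D^α v (t) = t^(-α) (v t - v 0) + ∫₀ᵗ α (t-s)^(-α-1) (v t - v s) ds`.
It equals `J^(1-α) (∂ₜ v) (t)` as soon as `∂ₜ v` is integrable up to time `0` and `v` is
right-continuous at `0` (`caputo_eq_fracInt`). It is also meaningful for functions that are only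
bounded near `t = 0`, possibly with a jump at `0` (the jump then counts as a Dirac mass in
`∂ₜ v`). -/
def caputo {X : Type*} [NormedAddCommGroup X] [NormedSpace ℝ X]
    (α : ℝ) (v : ℝ → X) (t : ℝ) : X :=
  (Real.Gamma (1 - α))⁻¹ •
    (t ^ (-α) • (v t - v 0) + ∫ s in (0 : ℝ)..t, (α * (t - s) ^ (-α - 1)) • (v t - v s))

theorem integral_caputo_weight {α t r : ℝ} (hrt : r < t) (hr0 : 0 ≤ r) :
    ∫ s in (0 : ℝ)..r, α * (t - s) ^ (-α - 1) = (t - r) ^ (-α) - t ^ (-α) := by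
  have hd : ∀ s ∈ uIcc 0 r,
      HasDerivAt (fun s : ℝ => (t - s) ^ (-α)) (α * (t - s) ^ (-α - 1)) s := by
    intro s hs
    rw [uIcc_of_le hr0] at hs
    have hpos : t - s ≠ 0 := by linarith [hs.2]
    have h1 : HasDerivAt (fun s : ℝ => t - s) (-1) s := by
      simpa using (hasDerivAt_id s).const_sub t
    have h2 := h1.rpow_const (p := -α) (Or.inl hpos)
    convert h2 using 1
    ring
  rw [intervalIntegral.integral_eq_sub_of_hasDerivAt hd]
  · simp
  · apply ContinuousOn.intervalIntegrable
    intro s hs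
    rw [uIcc_of_le hr0] at hs
    have hpos : t - s ≠ 0 := by linarith [hs.2]
    apply ContinuousAt.continuousWithinAt
    exact continuousAt_const.mul
      ((continuousAt_const.sub continuousAt_id).rpow_const (Or.inl hpos))

/-- Consistency with the definition `D^α v = J^(1-α) (∂ₜ v)`: here `g` is the weak time
derivative of `v`. -/
theorem caputo_eq_fracInt {X : Type*} [NormedAddCommGroup X] [NormedSpace ℝ X] [CompleteSpace X]
    {α t : ℝ} (h0 : 0 < α) (ht : 0 < t) {v g : ℝ → X}
    (hg : IntervalIntegrable g volume 0 t)
    (hgt : IntervalIntegrable (fun s => (t - s) ^ (-α) • g s) volume 0 t)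
    (hv : ∀ s ∈ Icc 0 t, v t - v s = ∫ r in s..t, g r) :
    caputo α v t = fracInt (1 - α) g t := by
  set μ : Measure ℝ := volume.restrict (Ioo 0 t) with hμ
  have hgI : Integrable g μ := by
    rw [intervalIntegrable_iff_integrableOn_Ioo_of_le ht.le] at hg; exact hg
  have hgtI : Integrable (fun s => (t - s) ^ (-α) • g s) μ := by
    rw [intervalIntegrable_iff_integrableOn_Ioo_of_le ht.le] at hgt; exact hgt
  have hmem : ∀ᵐ r ∂μ, r ∈ Ioo 0 t := ae_restrict_mem measurableSet_Ioo
  -- the kernel on the triangle `s < r`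
  let k : ℝ → ℝ → ℝ := fun s r => if s < r then α * (t - s) ^ (-α - 1) else 0
  have hk_eq : ∀ r, (fun s => k s r) = (Iio r).indicator (fun s => α * (t - s) ^ (-α - 1)) := by
    intro r; funext s; simp [k, indicator]
  have hk0 : ∀ s ∈ Ioo 0 t, ∀ r, 0 ≤ k s r := by
    intro s hs r
    have : 0 ≤ t - s := by linarith [hs.2]
    simp only [k]; split_ifs
    · positivity
    · exact le_rfl
  have hres : ∀ r ∈ Ioo 0 t, Iio r ∩ Ioo 0 t = Ioo 0 r := by
    intro r hr; ext s
    simp only [mem_inter_iff, mem_Iio, mem_Ioo]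
    constructor
    · rintro ⟨a, b, c⟩; exact ⟨b, a⟩
    · rintro ⟨a, b⟩; exact ⟨b, a, b.trans hr.2⟩
  have hk_int : ∀ r ∈ Ioo 0 t, Integrable (fun s => k s r) μ := by
    intro r hr
    rw [hk_eq, integrable_indicator_iff measurableSet_Iio, IntegrableOn, hμ,
      Measure.restrict_restrict measurableSet_Iio, hres r hr]
    have : IntegrableOn (fun s : ℝ => α * (t - s) ^ (-α - 1)) (Icc 0 r) := by
      apply ContinuousOn.integrableOn_Icc
      intro s hs
      have hpos : t - s ≠ 0 := by linarith [hs.2, hr.2]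
      apply ContinuousAt.continuousWithinAt
      exact continuousAt_const.mul
        ((continuousAt_const.sub continuousAt_id).rpow_const (Or.inl hpos))
    exact this.mono_set Ioo_subset_Icc_self
  have hk_val : ∀ r ∈ Ioo 0 t, ∫ s, k s r ∂μ = (t - r) ^ (-α) - t ^ (-α) := by
    intro r hr
    rw [hk_eq, integral_indicator measurableSet_Iio, hμ,
      Measure.restrict_restrict measurableSet_Iio, hres r hr,
      ← integral_Ioc_eq_integral_Ioo, ← intervalIntegral.integral_of_le hr.1.le,
      integral_caputo_weight hr.2 hr.1.le]
  have hkm : Measurable (Function.uncurry k) := by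
    apply Measurable.ite (measurableSet_lt measurable_fst measurable_snd)
    · fun_prop
    · exact measurable_const
  have hF : Integrable (Function.uncurry fun s r => k s r • g r) (μ.prod μ) := by
    have hmeas : AEStronglyMeasurable (Function.uncurry fun s r => k s r • g r) (μ.prod μ) :=
      hkm.aestronglyMeasurable.smul hgI.aestronglyMeasurable.comp_snd
    rw [integrable_prod_iff' hmeas]
    constructor
    · filter_upwards [hmem] with r hr
      exact (hk_int r hr).smul_const (g r)
    · have : Integrable (fun r => ((t - r) ^ (-α) - t ^ (-α)) * ‖g r‖) μ := by
        have h1 := hgtI.norm.sub (hgI.norm.const_mul (t ^ (-α)))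
        refine h1.congr ?_
        filter_upwards [hmem] with r hr
        have : 0 ≤ t - r := by linarith [hr.2]
        simp only [Pi.sub_apply, norm_smul, Real.norm_eq_abs]
        rw [abs_of_nonneg (by positivity)]
        ring
      refine this.congr ?_
      filter_upwards [hmem] with r hr
      rw [← hk_val r hr, ← integral_mul_const]
      apply integral_congr_ae
      filter_upwards [hmem] with s hs
      simp only [Function.uncurry, norm_smul, Real.norm_eq_abs]
      rw [abs_of_nonneg (hk0 s hs r)]
  have hswap := integral_integral_swap hF
  have hL : ∫ s in (0 : ℝ)..t, (α * (t - s) ^ (-α - 1)) • (v t - v s)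
      = ∫ s, ∫ r, k s r • g r ∂μ ∂μ := by
    rw [intervalIntegral.integral_of_le ht.le, integral_Ioc_eq_integral_Ioo]
    apply integral_congr_ae
    filter_upwards [hmem] with s hs
    rw [hv s ⟨hs.1.le, hs.2.le⟩, intervalIntegral.integral_of_le hs.2.le,
      integral_Ioc_eq_integral_Ioo, ← integral_smul]
    have e1 : (fun r => k s r • g r)
        = (Ioi s).indicator (fun r => (α * (t - s) ^ (-α - 1)) • g r) := by
      funext r
      by_cases h : s < r <;> simp [k, h]
    rw [e1, integral_indicator measurableSet_Ioi, hμ,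
      Measure.restrict_restrict measurableSet_Ioi]
    congr 2
    ext r
    simp only [mem_inter_iff, mem_Ioi, mem_Ioo]
    constructor
    · rintro ⟨a, b⟩; exact ⟨a, hs.1.trans a, b⟩
    · rintro ⟨a, _, b⟩; exact ⟨a, b⟩
  have hR : ∫ r, ∫ s, k s r • g r ∂μ ∂μ
      = ∫ r, ((t - r) ^ (-α) • g r - t ^ (-α) • g r) ∂μ := by
    apply integral_congr_ae
    filter_upwards [hmem] with r hr
    rw [integral_smul_const, hk_val r hr, sub_smul]
  have hgint : v t - v 0 = ∫ r, g r ∂μ := by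
    rw [hv 0 ⟨le_rfl, ht.le⟩, intervalIntegral.integral_of_le ht.le,
      integral_Ioc_eq_integral_Ioo]
  have hgc : Integrable (fun r => t ^ (-α) • g r) μ := hgI.smul (t ^ (-α))
  unfold caputo fracInt
  rw [hL, hswap, hR, integral_sub hgtI hgc, integral_smul, hgint,
    intervalIntegral.integral_of_le ht.le, integral_Ioc_eq_integral_Ioo]
  have e2 : (1 - α - 1 : ℝ) = -α := by ring
  rw [e2]
  congr 1
  abel

/-- Generalized Mittag-Leffler function `E_{α,β}(z) = ∑ₖ zᵏ / Γ(α k + β)`. -/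
def mittagLeffler (α β z : ℝ) : ℝ :=
  ∑' k : ℕ, (Real.Gamma (α * k + β))⁻¹ * z ^ k

/-- The kernel `r ↦ r^(α-1) E_{α,α}(-λ r^α)`, `r > 0`. -/
def resolventKernel (α lam r : ℝ) : ℝ :=
  r ^ (α - 1) * mittagLeffler α α (-lam * r ^ α)

/-- The operator `(D_t^α + λ)⁻¹`, i.e.
`v ↦ ∫₀ᵗ (t-s)^(α-1) E_{α,α}(-λ (t-s)^α) v(s) ds`. -/
def caputoResolvent (α lam : ℝ) (v : ℝ → ℝ) (t : ℝ) : ℝ :=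
  ∫ s in (0 : ℝ)..t, resolventKernel α lam (t - s) * v s

/-- The same integral with values in `[0,∞]`, for a function `v ≥ 0` (the kernel is positive):
it is `∞` when the integral diverges. -/
def caputoResolventENN (α lam : ℝ) (v : ℝ → ℝ) (t : ℝ) : ℝ≥0∞ :=
  ∫⁻ s in Ioo 0 t, ENNReal.ofReal (resolventKernel α lam (t - s) * v s)

/-! ### Regularity in time -/

/-- `v ∈ L_∞(a, b; X)`. -/
def MemLinfty {X : Type*} [NormedAddCommGroup X] (a b : ℝ) (v : ℝ → X) : Prop :=
  MemLp v ∞ (volume.restrict (Ioo a b))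

/-- `v ∈ W^{1,∞}(a, b; X)` (for the continuous representative, defined on `[a, b]`): `v` is bounded
and is a primitive of some `g ∈ L_∞(a, b; X)`, its weak time derivative. -/
def MemW1infty {X : Type*} [NormedAddCommGroup X] [NormedSpace ℝ X] (a b : ℝ) (v : ℝ → X) : Prop :=
  MemLinfty a b v ∧ ∃ g : ℝ → X, MemLinfty a b g ∧
    ∀ s ∈ Icc a b, ∀ r ∈ Icc a b, v r - v s = ∫ τ in s..r, g τ

/-- `v ∈ L_∞(0,t;X) ∩ W^{1,∞}(ε,t;X)` for any `0 < ε < t ≤ T`. -/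
def TimeRegular {X : Type*} [NormedAddCommGroup X] [NormedSpace ℝ X] (T : ℝ) (v : ℝ → X) : Prop :=
  ∀ ε t : ℝ, 0 < ε → ε < t → t ≤ T → MemLinfty 0 t v ∧ MemW1infty ε t v

/-! ### The spatial setting -/

/-- `ℝᵈ`. -/
abbrev Rd (d : ℕ) : Type := EuclideanSpace ℝ (Fin d)

/-- `L_2(Ω)`. -/
abbrev L2 {d : ℕ} (Ω : Set (Rd d)) : Type := Lp ℝ 2 (volume.restrict Ω)

/-- `L_2(Ω)ᵈ`. -/
abbrev L2Vec {d : ℕ} (Ω : Set (Rd d)) : Type := Lp (Rd d) 2 (volume.restrict Ω)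

/-- `φ ∈ C_c^∞(Ω)`. -/
def IsTest {d : ℕ} (Ω : Set (Rd d)) (φ : Rd d → ℝ) : Prop :=
  ContDiff ℝ ∞ φ ∧ HasCompactSupport φ ∧ tsupport φ ⊆ Ω

/-- `H_0^1(Ω)`, realised as the set of pairs `(v, ∇v)` with `v ∈ H_0^1(Ω)`: the closure
of `{(φ, ∇φ) : φ ∈ C_c^∞(Ω)}` in `L_2(Ω) × L_2(Ω)ᵈ`, i.e. the closure of `C_c^∞(Ω)` in the
norm of `H^1(Ω)`. -/
def H01 {d : ℕ} (Ω : Set (Rd d)) : Set (L2 Ω × L2Vec Ω) :=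
  closure {p | ∃ φ : Rd d → ℝ, IsTest Ω φ ∧
    (p.1 : Rd d → ℝ) =ᵐ[volume.restrict Ω] φ ∧
    (p.2 : Rd d → Rd d) =ᵐ[volume.restrict Ω] gradient φ}

/-- A linear second-order (uniformly) elliptic operator on `Ω` with bounded measurable
coefficients, `𝓛 v = -div (A ∇v + v p) + q · ∇v + c v`. -/
structure EllipticOperator {d : ℕ} (Ω : Set (Rd d)) where
  A : Rd d → Rd d →L[ℝ] Rd d
  p : Rd d → Rd d
  q : Rd d → Rd d
  c : Rd d → ℝ
  memLp_A : MemLp A ∞ (volume.restrict Ω)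
  memLp_p : MemLp p ∞ (volume.restrict Ω)
  memLp_q : MemLp q ∞ (volume.restrict Ω)
  memLp_c : MemLp c ∞ (volume.restrict Ω)
  elliptic : ∃ θ : ℝ, 0 < θ ∧ ∀ᵐ x ∂(volume.restrict Ω), ∀ ξ : Rd d,
    θ * ‖ξ‖ ^ 2 ≤ inner ℝ (A x ξ) ξ

/-- `⟨𝓛 v, w⟩`, where `dv` and `dw` are the gradients of `v` and `w`. -/
def EllipticOperator.pairing {d : ℕ} {Ω : Set (Rd d)} (L : EllipticOperator Ω)
    (v : Rd d → ℝ) (dv : Rd d → Rd d) (w : Rd d → ℝ) (dw : Rd d → Rd d) : ℝ :=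
  ∫ x in Ω, (inner ℝ (L.A x (dv x)) (dw x) + v x * inner ℝ (L.p x) (dw x)
    + inner ℝ (L.q x) (dv x) * w x + L.c x * v x * w x)

/-- `v(·,t) ∈ H_0^1(Ω)`, and `(D_t^α + 𝓛) v(·,t) - f(·,t) = R` in `Ω` in the sense of
distributions, where `R ∈ L_2(Ω)`. -/
def HasResidualAt {d : ℕ} {Ω : Set (Rd d)} (L : EllipticOperator Ω) (α : ℝ)
    (f : Rd d → ℝ → ℝ) (v : ℝ → L2 Ω) (t : ℝ) (R : L2 Ω) : Prop :=
  ∃ dv : L2Vec Ω, (v t, dv) ∈ H01 Ω ∧ ∀ φ : Rd d → ℝ, IsTest Ω φ →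
    (∫ x in Ω, caputo α v t x * φ x) + L.pairing (v t) dv φ (gradient φ)
      - (∫ x in Ω, f x t * φ x) = ∫ x in Ω, R x * φ x

/-- `u` solves `D_t^α u + 𝓛 u = f` in `Ω × (0,T]`, `u(·,0) = u0` in `Ω`, `u = 0` on `∂Ω` for
`t > 0`. -/
def IsSolution {d : ℕ} {Ω : Set (Rd d)} (L : EllipticOperator Ω) (α T : ℝ)
    (f : Rd d → ℝ → ℝ) (u0 : L2 Ω) (u : ℝ → L2 Ω) : Prop :=
  u 0 = u0 ∧ ∀ t ∈ Ioc 0 T, HasResidualAt L α f u t 0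

end

/-! Put `e = uh - u` and `w = ‖e‖`, so `w 0 = 0`. Subtracting the weak equations removes `f`. What
remains is continuous in the test pair `(φ, ∇φ)` for the `L2` topology, so it may be tested with `e`
itself (`HasResidualAt.energy_identity`). Since the Caputo weights are nonnegative, Cauchy–Schwarz
gives `‖e‖ D^α ‖e‖ ≤ ⟪D^α e, e⟫` (`norm_mul_caputo_norm_le`). With the lower bound on the elliptic
form this yields the scalar inequality `D^α w + λ w ≤ ‖R‖` (`caputo_norm_add_le`).

It remains to invert `D^α + λ` in an order-preserving way (`le_integral_resolventKernel_mul`). Let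
`k = powKernel α` be the kernel of `J^α`, and `K` the resolvent kernel. Summing its series gives `λ
K * k = k - K`. If `w = k * D^α w`, then `K * (D^α w + λ w) = K * D^α w + (k - K) * D^α w = w`, and
`K > 0` turns the differential inequality into the bound.

Two points carry the analysis. Positivity of `K` is immediate from its series for `λ ≤ 0`. For `λ >
0` it follows from the Volterra equation and the log-convexity of `k`, by contradiction at a first
zero (`resolventKernel_pos`). The inversion `w = k * D^α w` is delicate because `w` is only bounded
near time `0`, where `D^α w` need not be absolutely integrable a priori. On `(ε, t)` it holds up to
an explicit error that vanishes with `ε` (`abs_sub_integral_caputo_le`), and the upper bound on `D^α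
w` then supplies integrability up to `0` (`integral_powKernel_mul_caputo`). -/

open Filter Topology

/-! ### Riemann–Liouville kernels and the Beta integral. -/

/-- The kernel `r ↦ r^(b-1) / Γ(b)` of the Riemann–Liouville integral of order `b`. -/
noncomputable def powKernel (b r : ℝ) : ℝ := (Real.Gamma b)⁻¹ * r ^ (b - 1)

theorem measurable_powKernel (b : ℝ) : Measurable (powKernel b) := by
  unfold powKernel; fun_prop

theorem powKernel_pos {b r : ℝ} (hb : 0 < b) (hr : 0 < r) : 0 < powKernel b r :=
  mul_pos (inv_pos.2 (Real.Gamma_pos_of_pos hb)) (Real.rpow_pos_of_pos hr _)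

theorem powKernel_nonneg {b r : ℝ} (hb : 0 < b) (hr : 0 ≤ r) : 0 ≤ powKernel b r :=
  mul_nonneg (inv_pos.2 (Real.Gamma_pos_of_pos hb)).le (Real.rpow_nonneg hr _)

/-- Each endpoint carries one integrable singularity, so the interval is cut at `t / 2`. The right
half is the reflection `s ↦ t - s` of the left half with `a` and `b` exchanged. -/
theorem intervalIntegrable_beta {a b t : ℝ} (ha : 0 < a) (hb : 0 < b) (ht : 0 < t) :
    IntervalIntegrable (fun s : ℝ => s ^ (a - 1) * (t - s) ^ (b - 1)) volume 0 t := by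
  have key : ∀ {a b : ℝ}, 0 < a →
      IntervalIntegrable (fun s : ℝ => s ^ (a - 1) * (t - s) ^ (b - 1)) volume 0 (t / 2) := by
    intro a b ha
    refine (intervalIntegral.intervalIntegrable_rpow' (by linarith)).mul_continuousOn ?_
    intro s hs
    rw [uIcc_of_le (by linarith)] at hs
    exact ((continuousAt_const.sub continuousAt_id).rpow_const
      (Or.inl (by simp; linarith [hs.2]))).continuousWithinAt
  refine (key ha).trans ?_
  have h2 := ((key (a := b) (b := a) hb).comp_sub_left t).symm
  have e : t - t / 2 = t / 2 := by ring
  rw [e, sub_zero] at h2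
  refine h2.congr ?_
  intro s _
  simp only [sub_sub_cancel]
  ring

theorem integral_beta {a b t : ℝ} (ha : 0 < a) (hb : 0 < b) (ht : 0 < t) :
    ∫ s in (0 : ℝ)..t, s ^ (a - 1) * (t - s) ^ (b - 1)
      = t ^ (a + b - 1) * (Real.Gamma a * Real.Gamma b / Real.Gamma (a + b)) := by
  have h := Complex.betaIntegral_scaled (a : ℂ) (b : ℂ) ht
  rw [Complex.betaIntegral_eq_Gamma_mul_div _ _ (by simpa) (by simpa), ← Complex.ofReal_add,
    Complex.Gamma_ofReal, Complex.Gamma_ofReal, Complex.Gamma_ofReal] at h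
  apply Complex.ofReal_injective
  rw [← intervalIntegral.integral_ofReal]
  push_cast
  rw [Complex.ofReal_cpow ht.le]
  push_cast at h ⊢
  rw [← h]
  apply intervalIntegral.integral_congr
  intro s hs
  rw [uIcc_of_le ht.le] at hs
  simp only
  rw [Complex.ofReal_cpow hs.1, Complex.ofReal_cpow (by linarith [hs.2])]
  push_cast
  rfl

theorem integrableOn_powKernel_mul {a b s t : ℝ} (ha : 0 < a) (hb : 0 < b) (hst : s < t) :
    IntegrableOn (fun τ => powKernel a (t - τ) * powKernel b (τ - s)) (Ioo s t) := by
  have h := (intervalIntegrable_beta hb ha (sub_pos.2 hst)).comp_sub_right s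
  rw [zero_add, sub_add_cancel, intervalIntegrable_iff_integrableOn_Ioo_of_le hst.le] at h
  refine (h.const_mul ((Real.Gamma a)⁻¹ * (Real.Gamma b)⁻¹)).congr
    (Eventually.of_forall fun τ => ?_)
  simp only [powKernel, sub_sub_sub_cancel_right]
  ring

/-- The semigroup law `J^a J^b = J^(a+b)` at the level of kernels: a shifted Beta integral. -/
theorem integral_powKernel_mul {a b s t : ℝ} (ha : 0 < a) (hb : 0 < b) (hst : s < t) :
    ∫ τ in Ioo s t, powKernel a (t - τ) * powKernel b (τ - s) = powKernel (a + b) (t - s) := by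
  have h := integral_beta hb ha (sub_pos.2 hst)
  have h2 := intervalIntegral.integral_comp_sub_right (a := s) (b := t)
    (fun r : ℝ => r ^ (b - 1) * (t - s - r) ^ (a - 1)) s
  rw [sub_self, h, intervalIntegral.integral_of_le hst.le, integral_Ioc_eq_integral_Ioo] at h2
  have e : ∀ τ, powKernel a (t - τ) * powKernel b (τ - s) = ((Real.Gamma a)⁻¹ * (Real.Gamma b)⁻¹) *
      ((τ - s) ^ (b - 1) * (t - s - (τ - s)) ^ (a - 1)) := by
    intro τ
    simp only [powKernel, sub_sub_sub_cancel_right]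
    ring
  simp_rw [e]
  rw [integral_const_mul, h2, powKernel, add_comm b a]
  have h3 := (Real.Gamma_pos_of_pos ha).ne'
  have h4 := (Real.Gamma_pos_of_pos hb).ne'
  field_simp

theorem integrableOn_powKernel {a s t : ℝ} (ha : 0 < a) :
    IntegrableOn (fun τ => powKernel a (t - τ)) (Ioo s t) := by
  rcases le_or_gt t s with h | h
  · simp [Ioo_eq_empty_of_le h]
  have h0 := ((intervalIntegral.intervalIntegrable_rpow' (a := 0) (b := t - s)
    (by linarith : -1 < a - 1)).comp_sub_left t).symm
  rw [sub_sub_cancel, sub_zero, intervalIntegrable_iff_integrableOn_Ioo_of_le h.le] at h0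
  exact h0.const_mul _

theorem powKernel_one (r : ℝ) : powKernel 1 r = 1 := by simp [powKernel]

theorem integral_powKernel {a s t : ℝ} (ha : 0 < a) (hst : s < t) :
    ∫ τ in Ioo s t, powKernel a (t - τ) = powKernel (a + 1) (t - s) := by
  simpa [powKernel_one] using integral_powKernel_mul ha one_pos hst

/-! ### Fubini on the triangle for truncated convolutions. -/

section Volterra

variable {a t : ℝ} {φ ψ Θ h : ℝ → ℝ}

/-- Integrability on the triangle `a < s < τ < t`. -/
theorem integrable_volterra (hφ : Measurable φ) (hψ : Measurable ψ)
    (hh : AEStronglyMeasurable h (volume.restrict (Ioo a t)))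
    (hφψ : ∀ s ∈ Ioo a t, IntegrableOn (fun τ => φ (t - τ) * ψ (τ - s)) (Ioo s t))
    (hΘ : ∀ s ∈ Ioo a t, ∫ τ in Ioo s t, |φ (t - τ) * ψ (τ - s)| ≤ Θ (t - s))
    (hint : IntegrableOn (fun s => Θ (t - s) * h s) (Ioo a t)) :
    Integrable (Function.uncurry fun τ s => (Ioi s).indicator
      (fun τ => φ (t - τ) * ψ (τ - s) * h s) τ)
      ((volume.restrict (Ioo a t)).prod (volume.restrict (Ioo a t))) := by
  set μ : Measure ℝ := volume.restrict (Ioo a t) with hμ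
  have hmem : ∀ᵐ r ∂μ, r ∈ Ioo a t := ae_restrict_mem measurableSet_Ioo
  have hmeas : AEStronglyMeasurable (Function.uncurry fun τ s => (Ioi s).indicator
      (fun τ => φ (t - τ) * ψ (τ - s) * h s) τ) (μ.prod μ) := by
    have e : (Function.uncurry fun τ s => (Ioi s).indicator
        (fun τ => φ (t - τ) * ψ (τ - s) * h s) τ) = {p : ℝ × ℝ | p.2 < p.1}.indicator
        (fun p => φ (t - p.1) * ψ (p.1 - p.2) * h p.2) := by
      ext ⟨τ, s⟩
      by_cases hs : s < τ <;> simp [Function.uncurry, hs]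
    rw [e]
    refine AEStronglyMeasurable.indicator ?_ (measurableSet_lt measurable_snd measurable_fst)
    refine AEStronglyMeasurable.mul ?_ hh.comp_snd
    exact Measurable.aestronglyMeasurable (by fun_prop)
  have hres : ∀ s ∈ Ioo a t, μ.restrict (Ioi s) = volume.restrict (Ioo s t) := by
    intro s hs
    rw [hμ, Measure.restrict_restrict measurableSet_Ioi]
    congr 1
    ext r
    simp only [mem_inter_iff, mem_Ioi, mem_Ioo]
    exact ⟨fun ⟨x, _, z⟩ => ⟨x, z⟩, fun ⟨x, z⟩ => ⟨x, hs.1.trans x, z⟩⟩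
  rw [integrable_prod_iff' hmeas]
  constructor
  · filter_upwards [hmem] with s hs
    simp only [Function.uncurry]
    change Integrable ((Ioi s).indicator fun τ => φ (t - τ) * ψ (τ - s) * h s) μ
    rw [integrable_indicator_iff measurableSet_Ioi, IntegrableOn, hres s hs]
    exact (hφψ s hs).mul_const _
  · refine hint.norm.mono' hmeas.norm.prod_swap.integral_prod_right' ?_
    filter_upwards [hmem] with s hs
    have e : ∀ τ, ‖Function.uncurry (fun τ s => (Ioi s).indicator
        (fun τ => φ (t - τ) * ψ (τ - s) * h s) τ) (τ, s)‖
        = (Ioi s).indicator (fun τ => |φ (t - τ) * ψ (τ - s)| * |h s|) τ := by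
      intro τ
      simp only [Function.uncurry, norm_indicator_eq_indicator_norm, Real.norm_eq_abs, abs_mul]
    have h0 : 0 ≤ ∫ τ in Ioo s t, |φ (t - τ) * ψ (τ - s)| :=
      integral_nonneg fun τ => abs_nonneg _
    simp_rw [e]
    rw [integral_indicator measurableSet_Ioi, hres s hs, integral_mul_const, Real.norm_eq_abs,
      Real.norm_eq_abs, abs_mul, abs_mul, abs_abs, abs_of_nonneg h0]
    exact mul_le_mul_of_nonneg_right ((hΘ s hs).trans (le_abs_self _)) (abs_nonneg _)

/-- Associativity of the truncated convolution: `φ * (ψ * h) = (φ * ψ) * h` at time `t`. -/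
theorem volterra_assoc (hφ : Measurable φ) (hψ : Measurable ψ)
    (hh : AEStronglyMeasurable h (volume.restrict (Ioo a t)))
    (hφψ : ∀ s ∈ Ioo a t, IntegrableOn (fun τ => φ (t - τ) * ψ (τ - s)) (Ioo s t))
    (hΘ : ∀ s ∈ Ioo a t, ∫ τ in Ioo s t, |φ (t - τ) * ψ (τ - s)| ≤ Θ (t - s))
    (hint : IntegrableOn (fun s => Θ (t - s) * h s) (Ioo a t)) :
    (∀ᵐ τ ∂volume.restrict (Ioo a t),
      IntegrableOn (fun s => φ (t - τ) * ψ (τ - s) * h s) (Ioo a τ)) ∧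
    IntegrableOn (fun τ => ∫ s in Ioo a τ, φ (t - τ) * ψ (τ - s) * h s) (Ioo a t) ∧
    ∫ τ in Ioo a t, ∫ s in Ioo a τ, φ (t - τ) * ψ (τ - s) * h s
      = ∫ s in Ioo a t, (∫ τ in Ioo s t, φ (t - τ) * ψ (τ - s)) * h s := by
  have hF := integrable_volterra hφ hψ hh hφψ hΘ hint
  have hmem : ∀ᵐ r ∂volume.restrict (Ioo a t), r ∈ Ioo a t := ae_restrict_mem measurableSet_Ioo
  have hres1 : ∀ s ∈ Ioo a t, Ioi s ∩ Ioo a t = Ioo s t := by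
    intro s hs
    ext r
    simp only [mem_inter_iff, mem_Ioi, mem_Ioo]
    exact ⟨fun ⟨x, _, z⟩ => ⟨x, z⟩, fun ⟨x, z⟩ => ⟨x, hs.1.trans x, z⟩⟩
  have hres2 : ∀ s ∈ Ioo a t, Iio s ∩ Ioo a t = Ioo a s := by
    intro s hs
    ext r
    simp only [mem_inter_iff, mem_Iio, mem_Ioo]
    exact ⟨fun ⟨x, y, _⟩ => ⟨y, x⟩, fun ⟨x, z⟩ => ⟨z, x, z.trans hs.2⟩⟩
  have e : ∀ τ, (fun s => (Ioi s).indicator (fun τ => φ (t - τ) * ψ (τ - s) * h s) τ)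
      = (Iio τ).indicator (fun s => φ (t - τ) * ψ (τ - s) * h s) := by
    intro τ
    ext s
    by_cases hs : s < τ <;> simp [hs]
  have hI : ∀ τ ∈ Ioo a t, ∫ s in Ioo a t,
      (Ioi s).indicator (fun τ => φ (t - τ) * ψ (τ - s) * h s) τ
      = ∫ s in Ioo a τ, φ (t - τ) * ψ (τ - s) * h s := by
    intro τ hτ
    rw [e, integral_indicator measurableSet_Iio, Measure.restrict_restrict measurableSet_Iio,
      hres2 τ hτ]
  refine ⟨?_, ?_, ?_⟩
  · filter_upwards [hF.prod_right_ae, hmem] with τ h1 hτ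
    simp only [Function.uncurry] at h1
    rwa [e, integrable_indicator_iff measurableSet_Iio, IntegrableOn,
      Measure.restrict_restrict measurableSet_Iio, hres2 τ hτ] at h1
  · refine hF.integral_prod_left.congr ?_
    filter_upwards [hmem] with τ hτ
    exact hI τ hτ
  · rw [setIntegral_congr_fun measurableSet_Ioo fun τ hτ => (hI τ hτ).symm,
      integral_integral_swap hF]
    refine setIntegral_congr_fun measurableSet_Ioo fun s hs => ?_
    rw [← integral_mul_const, integral_indicator (f := fun τ => φ (t - τ) * ψ (τ - s) * h s)
      measurableSet_Ioi, Measure.restrict_restrict measurableSet_Ioi, hres1 s hs]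

end Volterra

/-! ### Convergence and continuity of the Mittag-Leffler series. -/

/-- Log-convexity of `Γ`, with `x + 1` written as a convex combination of `x + a` and `x + a + 1`,
gives `x Γ(x) ≤ (x + a)^(1-a) Γ(x + a)`. The factor `2` comes from `x + a ≤ 2 x`. -/
theorem Gamma_div_Gamma_add_le {x a : ℝ} (ha0 : 0 < a) (ha1 : a < 1) (hx : 1 ≤ x) :
    Real.Gamma x / Real.Gamma (x + a) ≤ 2 * x ^ (-a) := by
  have hx0 : 0 < x := by linarith
  have hxa : 0 < x + a := by linarith
  have h := Real.Gamma_mul_add_mul_le_rpow_Gamma_mul_rpow_Gamma hxa (by linarith : 0 < x + a + 1)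
    ha0 (sub_pos.2 ha1) (by ring)
  have e : a * (x + a) + (1 - a) * (x + a + 1) = x + 1 := by ring
  have hG := Real.Gamma_pos_of_pos hxa
  rw [e, Real.Gamma_add_one hx0.ne', Real.Gamma_add_one hxa.ne', Real.mul_rpow hxa.le hG.le,
    mul_left_comm, ← Real.rpow_add hG, add_sub_cancel, Real.rpow_one] at h
  rw [div_le_iff₀ hG]
  have h2 : (x + a) ^ (1 - a) ≤ 2 * (x * x ^ (-a)) := by
    have h3 : x * x ^ (-a) = x ^ (1 - a) := by
      rw [sub_eq_add_neg, Real.rpow_add hx0, Real.rpow_one]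
    calc (x + a) ^ (1 - a) ≤ (2 * x) ^ (1 - a) :=
          Real.rpow_le_rpow hxa.le (by linarith) (by linarith)
      _ = 2 ^ (1 - a) * x ^ (1 - a) := Real.mul_rpow (by norm_num) hx0.le
      _ ≤ 2 * x ^ (1 - a) := by
          gcongr
          simpa using Real.rpow_le_rpow_of_exponent_le (by norm_num : (1 : ℝ) ≤ 2)
            (by linarith : 1 - a ≤ 1)
      _ = _ := by rw [h3]
  have h4 := h.trans (mul_le_mul_of_nonneg_right h2 hG.le)
  refine le_of_mul_le_mul_left ?_ hx0
  linarith

/-- Ratio test: the ratio of consecutive terms is at most `2 (α k + β)^(-α) |z|`, which tends to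
`0`. -/
theorem summable_mittagLeffler {α β : ℝ} (hα0 : 0 < α) (hα1 : α < 1) (hβ : 0 < β) (z : ℝ) :
    Summable fun k : ℕ => (Real.Gamma (α * k + β))⁻¹ * z ^ k := by
  have hx : Tendsto (fun k : ℕ => α * (k : ℝ) + β) atTop atTop :=
    tendsto_atTop_add_const_right _ _ (tendsto_natCast_atTop_atTop.const_mul_atTop hα0)
  have h1 : Tendsto (fun k : ℕ => 2 * (α * (k : ℝ) + β) ^ (-α) * |z|) atTop (𝓝 (2 * 0 * |z|)) :=
    (((tendsto_rpow_neg_atTop hα0).comp hx).const_mul 2).mul_const _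
  rw [mul_zero, zero_mul] at h1
  refine summable_of_ratio_norm_eventually_le (r := 1 / 2) (by norm_num) ?_
  filter_upwards [h1.eventually_le_const (by norm_num : (0 : ℝ) < 1 / 2),
    hx.eventually_ge_atTop 1] with k hk1 hk2
  have hG := Real.Gamma_pos_of_pos (by linarith : 0 < α * (k : ℝ) + β)
  have hG2 := Real.Gamma_pos_of_pos (by linarith : 0 < α * (k : ℝ) + β + α)
  have h2 := Gamma_div_Gamma_add_le hα0 hα1 hk2
  have e : α * ((k + 1 : ℕ) : ℝ) + β = α * (k : ℝ) + β + α := by push_cast; ring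
  rw [e, norm_mul, norm_mul, norm_pow, norm_pow, pow_succ, Real.norm_eq_abs, Real.norm_eq_abs,
    Real.norm_eq_abs, abs_of_pos (inv_pos.2 hG), abs_of_pos (inv_pos.2 hG2)]
  calc (Real.Gamma (α * k + β + α))⁻¹ * (|z| ^ k * |z|)
      = (Real.Gamma (α * k + β) / Real.Gamma (α * k + β + α) * |z|) *
        ((Real.Gamma (α * k + β))⁻¹ * |z| ^ k) := by field_simp
    _ ≤ (1 / 2) * ((Real.Gamma (α * k + β))⁻¹ * |z| ^ k) := by
        gcongr
        exact (mul_le_mul_of_nonneg_right h2 (abs_nonneg z)).trans hk1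

theorem continuous_mittagLeffler {α β : ℝ} (hα0 : 0 < α) (hα1 : α < 1) (hβ : 0 < β) :
    Continuous (mittagLeffler α β) := by
  rw [continuous_iff_continuousAt]
  intro z
  have h : ContinuousOn (mittagLeffler α β) (Metric.ball 0 (|z| + 1)) := by
    refine continuousOn_tsum (u := fun k : ℕ => (Real.Gamma (α * k + β))⁻¹ * (|z| + 1) ^ k)
      (fun k => by fun_prop) (summable_mittagLeffler hα0 hα1 hβ _) ?_
    intro k y hy
    have hG := Real.Gamma_pos_of_pos (by positivity : 0 < α * (k : ℝ) + β)
    rw [mem_ball_zero_iff] at hy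
    rw [norm_mul, norm_pow, Real.norm_of_nonneg (inv_pos.2 hG).le]
    gcongr
  exact h.continuousAt (Metric.isOpen_ball.mem_nhds (by simp))

/-! ### The resolvent kernel: series, bounds and Volterra equation. -/

section Kernel

variable {α : ℝ}

theorem continuous_mittagLeffler_rpow (hα0 : 0 < α) (hα1 : α < 1) (lam : ℝ) :
    Continuous fun r : ℝ => mittagLeffler α α (-lam * r ^ α) :=
  (continuous_mittagLeffler hα0 hα1 hα0).comp
    (continuous_const.mul (Real.continuous_rpow_const hα0.le))

theorem mittagLeffler_zero (α β : ℝ) : mittagLeffler α β 0 = (Real.Gamma β)⁻¹ := by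
  rw [mittagLeffler, tsum_eq_single 0 (fun k hk => by simp [hk])]
  simp

theorem measurable_resolventKernel (hα0 : 0 < α) (hα1 : α < 1) (lam : ℝ) :
    Measurable (resolventKernel α lam) := by
  have := (continuous_mittagLeffler_rpow hα0 hα1 lam).measurable
  unfold resolventKernel
  fun_prop

theorem resolventKernel_eq (hα0 : 0 < α) (lam r : ℝ) : resolventKernel α lam r
    = (Real.Gamma α * mittagLeffler α α (-lam * r ^ α)) * powKernel α r := by
  have := (Real.Gamma_pos_of_pos hα0).ne'
  rw [resolventKernel, powKernel]
  field_simp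

theorem continuousOn_resolventKernel (hα0 : 0 < α) (hα1 : α < 1) (lam : ℝ) :
    ContinuousOn (resolventKernel α lam) (Ioi 0) := by
  intro r hr
  exact ((Real.continuousAt_rpow_const r _ (Or.inl (ne_of_gt hr))).mul
    (continuous_mittagLeffler_rpow hα0 hα1 lam).continuousAt).continuousWithinAt

/-- The Mittag-Leffler factor is continuous up to `r = 0`, hence bounded on `[0, t]`; the only
singularity is that of `powKernel α`. -/
theorem exists_resolventKernel_le (hα0 : 0 < α) (hα1 : α < 1) (lam t : ℝ) :
    ∃ C : ℝ, 0 ≤ C ∧ ∀ r ∈ Ioc 0 t, |resolventKernel α lam r| ≤ C * powKernel α r := by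
  obtain ⟨C, hC⟩ := (isCompact_Icc (a := 0) (b := t)).exists_bound_of_continuousOn
    (continuous_mittagLeffler_rpow hα0 hα1 lam).continuousOn
  refine ⟨Real.Gamma α * |C|, mul_nonneg (Real.Gamma_pos_of_pos hα0).le (abs_nonneg _),
    fun r hr => ?_⟩
  rw [resolventKernel_eq hα0, abs_mul, abs_mul, abs_of_pos (Real.Gamma_pos_of_pos hα0),
    abs_of_pos (powKernel_pos hα0 hr.1)]
  have := (hC r ⟨hr.1.le, hr.2⟩).trans (le_abs_self C)
  rw [Real.norm_eq_abs] at this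
  have h2 := powKernel_pos hα0 hr.1
  have h3 := Real.Gamma_pos_of_pos hα0
  gcongr

theorem resolventKernel_term {r : ℝ} (hr : 0 < r) (lam : ℝ) (j : ℕ) :
    r ^ (α - 1) * ((Real.Gamma (α * j + α))⁻¹ * (-lam * r ^ α) ^ j)
      = (-lam) ^ j * powKernel (α * (j + 1)) r := by
  have e : r ^ (α * ((j : ℝ) + 1) - 1) = r ^ (α - 1) * (r ^ α) ^ j := by
    rw [← Real.rpow_natCast, ← Real.rpow_mul hr.le, ← Real.rpow_add hr]
    congr 1
    ring
  rw [powKernel, e, mul_pow, mul_add, mul_one]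
  ring

/-- This is the Neumann series `∑ (-λ)^j J^(α(j+1))` of `(D^α + λ)⁻¹`, read on kernels. -/
theorem hasSum_resolventKernel (hα0 : 0 < α) (hα1 : α < 1) (lam : ℝ) {r : ℝ} (hr : 0 < r) :
    HasSum (fun j : ℕ => (-lam) ^ j * powKernel (α * (j + 1)) r) (resolventKernel α lam r) := by
  have h := ((summable_mittagLeffler hα0 hα1 hα0 (-lam * r ^ α)).hasSum).mul_left (r ^ (α - 1))
  simp_rw [resolventKernel_term hr] at h
  exact h

theorem integrableOn_resolventKernel_mul (hα0 : 0 < α) (hα1 : α < 1) (lam : ℝ) {b s t : ℝ}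
    (hb : 0 < b) (hst : s < t) :
    IntegrableOn (fun τ => resolventKernel α lam (t - τ) * powKernel b (τ - s)) (Ioo s t) := by
  obtain ⟨C, _, hC⟩ := exists_resolventKernel_le hα0 hα1 lam (t - s)
  refine ((integrableOn_powKernel_mul hα0 hb hst).const_mul C).mono'
    (Measurable.aestronglyMeasurable ?_) ?_
  · have := measurable_resolventKernel hα0 hα1 lam
    have := measurable_powKernel b
    fun_prop
  · filter_upwards [ae_restrict_mem measurableSet_Ioo] with τ hτ
    rw [norm_mul, Real.norm_eq_abs, Real.norm_eq_abs,
      abs_of_pos (powKernel_pos hb (sub_pos.2 hτ.1)), ← mul_assoc]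
    exact mul_le_mul_of_nonneg_right (hC _ ⟨by linarith [hτ.2], by linarith [hτ.1]⟩)
      (powKernel_nonneg hb (by linarith [hτ.1]))

/-- The Volterra equation `λ K * k = k - K`, where `k` is the kernel of `J^α`. -/
theorem lam_mul_integral_resolventKernel_mul (hα0 : 0 < α) (hα1 : α < 1) (lam : ℝ) {s t : ℝ}
    (hst : s < t) :
    lam * ∫ τ in Ioo s t, resolventKernel α lam (t - τ) * powKernel α (τ - s)
      = powKernel α (t - s) - resolventKernel α lam (t - s) := by
  set F : ℕ → ℝ → ℝ := fun j τ =>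
    (-lam) ^ j * (powKernel (α * (j + 1)) (t - τ) * powKernel α (τ - s)) with hF
  have hpos : ∀ j : ℕ, 0 < α * ((j : ℝ) + 1) := fun j => by positivity
  have hval : ∀ j : ℕ, ∫ τ in Ioo s t, powKernel (α * (j + 1)) (t - τ) * powKernel α (τ - s)
      = powKernel (α * ((j + 1 : ℕ) + 1)) (t - s) := by
    intro j
    rw [integral_powKernel_mul (hpos j) hα0 hst]
    congr 1
    push_cast
    ring
  have hint : ∀ j, IntegrableOn (F j) (Ioo s t) := fun j =>
    (integrableOn_powKernel_mul (hpos j) hα0 hst).const_mul _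
  have hnorm : ∀ j : ℕ, ∫ τ in Ioo s t, ‖F j τ‖
      = |lam| ^ j * powKernel (α * ((j + 1 : ℕ) + 1)) (t - s) := by
    intro j
    rw [← hval j, ← integral_const_mul]
    refine setIntegral_congr_fun measurableSet_Ioo fun τ hτ => ?_
    simp only [hF]
    rw [norm_mul, norm_pow, norm_neg, Real.norm_eq_abs, Real.norm_of_nonneg]
    exact mul_nonneg (powKernel_nonneg (hpos j) (by linarith [hτ.2]))
      (powKernel_nonneg hα0 (by linarith [hτ.1]))
  have hsum : Summable fun j => ∫ τ in Ioo s t, ‖F j τ‖ := by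
    simp_rw [hnorm]
    -- The norms are the series of the kernel with parameter `-|λ|`, shifted by one index and
    -- divided by `|λ|`; hence the separate case `λ = 0`.
    by_cases hl : lam = 0
    · refine summable_of_ne_finset_zero (s := {0}) fun j hj => ?_
      simp only [Finset.mem_singleton] at hj
      simp [hl, hj]
    have h := ((hasSum_resolventKernel hα0 hα1 (-|lam|) (sub_pos.2 hst)).summable.comp_injective
      (add_left_injective 1)).mul_left |lam|⁻¹
    refine h.congr fun j => ?_
    have : |lam| ≠ 0 := by simpa using hl
    simp only [Function.comp, neg_neg, pow_succ]
    field_simp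
  have h1 := (hasSum_integral_of_summable_integral_norm hint hsum).tsum_eq
  have h2 : ∫ τ in Ioo s t, ∑' j, F j τ
      = ∫ τ in Ioo s t, resolventKernel α lam (t - τ) * powKernel α (τ - s) := by
    refine setIntegral_congr_fun measurableSet_Ioo fun τ hτ => ?_
    have := (hasSum_resolventKernel hα0 hα1 lam (sub_pos.2 hτ.2)).mul_right (powKernel α (τ - s))
    simp only [hF, ← mul_assoc]
    exact this.tsum_eq
  have h3 := (hasSum_resolventKernel hα0 hα1 lam (sub_pos.2 hst))
  -- Convolution with `powKernel α` raises the index by one, so only the term `j = 0` of the series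
  -- survives in `k - K`.
  rw [← h2, ← h1, ← h3.tsum_eq, h3.summable.tsum_eq_zero_add, ← tsum_mul_left]
  simp only [hF, integral_const_mul, hval]
  have e : ∀ j : ℕ, (-lam) ^ (j + 1) * powKernel (α * ((j + 1 : ℕ) + 1)) (t - s)
      = -(lam * ((-lam) ^ j * powKernel (α * ((j + 1 : ℕ) + 1)) (t - s))) := by
    intro j; rw [pow_succ]; ring
  simp_rw [e, tsum_neg]
  simp

end Kernel

/-! ### Positivity of the resolvent kernel. -/

section Positivity

variable {α : ℝ}

theorem integral_Ioo_comp_sub (t : ℝ) (ht : 0 < t) (g : ℝ → ℝ) :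
    ∫ τ in Ioo 0 t, g (t - τ) = ∫ s in Ioo 0 t, g s := by
  have h := intervalIntegral.integral_comp_sub_left (a := 0) (b := t) g t
  rwa [sub_self, sub_zero, intervalIntegral.integral_of_le ht.le,
    intervalIntegral.integral_of_le ht.le, integral_Ioc_eq_integral_Ioo,
    integral_Ioc_eq_integral_Ioo] at h

theorem integrableOn_Ioo_comp_sub {t : ℝ} (ht : 0 < t) {g : ℝ → ℝ} (h : IntegrableOn g (Ioo 0 t)) :
    IntegrableOn (fun τ => g (t - τ)) (Ioo 0 t) := by
  rw [← intervalIntegrable_iff_integrableOn_Ioo_of_le ht.le] at h ⊢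
  simpa using (h.comp_sub_left t).symm

theorem powKernel_antitone (hα0 : 0 < α) (hα1 : α < 1) {r s : ℝ} (hr : 0 < r) (hrs : r ≤ s) :
    powKernel α s ≤ powKernel α r :=
  mul_le_mul_of_nonneg_left (Real.rpow_le_rpow_of_nonpos hr hrs (by linarith))
    (inv_pos.2 (Real.Gamma_pos_of_pos hα0)).le

/-- The kernel of `J^α` is log-convex. -/
theorem powKernel_mul_le (hα0 : 0 < α) (hα1 : α < 1) {s t t' : ℝ} (hs : 0 < s) (hst : s < t)
    (htt : t ≤ t') :
    powKernel α (t' - s) * powKernel α t ≤ powKernel α t' * powKernel α (t - s) := by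
  have h1 : ((t' - s) * t) ^ (α - 1) ≤ (t' * (t - s)) ^ (α - 1) := by
    refine Real.rpow_le_rpow_of_nonpos ?_ ?_ (by linarith)
    · exact mul_pos (by linarith) (by linarith)
    · nlinarith
  rw [Real.mul_rpow (by linarith) (by linarith), Real.mul_rpow (by linarith) (by linarith)] at h1
  have h2 := mul_self_nonneg (Real.Gamma α)⁻¹
  simp only [powKernel]
  nlinarith

theorem resolventKernel_pos_of_nonpos (hα0 : 0 < α) (hα1 : α < 1) {lam : ℝ} (hl : lam ≤ 0) {r : ℝ}
    (hr : 0 < r) : 0 < resolventKernel α lam r := by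
  have h := hasSum_resolventKernel hα0 hα1 lam hr
  have h2 : ∀ j : ℕ, 0 ≤ (-lam) ^ j * powKernel (α * (j + 1)) r := fun j =>
    mul_nonneg (pow_nonneg (by linarith) _) (powKernel_pos (by positivity) hr).le
  refine lt_of_lt_of_le ?_ (le_hasSum h 0 fun j _ => h2 j)
  simpa using powKernel_pos hα0 hr

/-- For `λ > 0`, let `t₀` be the first zero of `K` and `t < t₀` a point close to it. Log-convexity
bounds the part over `(0, t)` of the Volterra integral at `t₀` by `k(t₀) / k(t)` times the whole
integral at `t`. Comparing the two Volterra equations, the part over `(t, t₀)` must make up for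
`K(t) k(t₀) / k(t)`. If `K ≤ K(t)` on `(t, t₀)`, that part is too small when `t₀ - t` is small. -/
theorem resolventKernel_pos (hα0 : 0 < α) (hα1 : α < 1) (lam : ℝ) {r : ℝ} (hr : 0 < r) :
    0 < resolventKernel α lam r := by
  rcases le_or_gt lam 0 with hl | hl
  · exact resolventKernel_pos_of_nonpos hα0 hα1 hl hr
  by_contra! hK
  set K := resolventKernel α lam with hKdef
  set m : ℝ → ℝ := fun r => mittagLeffler α α (-lam * r ^ α) with hm
  have hmc : Continuous m := continuous_mittagLeffler_rpow hα0 hα1 lam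
  have hKm : ∀ x, K x = x ^ (α - 1) * m x := fun x => rfl
  have hKint : ∀ t, 0 < t → IntegrableOn (fun s => K s * powKernel α (t - s)) (Ioo 0 t) := by
    intro t ht
    have := integrableOn_Ioo_comp_sub ht (integrableOn_resolventKernel_mul hα0 hα1 lam hα0 ht)
    simpa using this
  have hVol : ∀ t, 0 < t →
      lam * ∫ s in Ioo 0 t, K s * powKernel α (t - s) = powKernel α t - K t := by
    intro t ht
    have h := lam_mul_integral_resolventKernel_mul hα0 hα1 lam ht
    rw [← integral_Ioo_comp_sub t ht] at h
    simpa using h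
  -- the first zero of `K`
  set S : Set ℝ := {x | 0 ≤ x ∧ m x ≤ 0} with hS
  have hSc : IsClosed S :=
    (isClosed_le continuous_const continuous_id).inter (isClosed_le hmc continuous_const)
  have hSb : BddBelow S := ⟨0, fun x hx => hx.1⟩
  have hSn : S.Nonempty := by
    refine ⟨r, hr.le, ?_⟩
    rw [hKm] at hK
    by_contra! h
    exact absurd hK (not_le.2 (mul_pos (Real.rpow_pos_of_pos hr _) h))
  set t₀ := sInf S with ht₀
  have htS : t₀ ∈ S := hSc.csInf_mem hSn hSb
  have h0 : 0 < t₀ := by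
    refine lt_of_le_of_ne htS.1 fun h => ?_
    have h1 := htS.2
    rw [← h] at h1
    simp only [hm, Real.zero_rpow hα0.ne', mul_zero, mittagLeffler_zero] at h1
    exact absurd h1 (not_le.2 (inv_pos.2 (Real.Gamma_pos_of_pos hα0)))
  have hKt₀ : K t₀ ≤ 0 := by
    rw [hKm]
    exact mul_nonpos_of_nonneg_of_nonpos (Real.rpow_nonneg h0.le _) htS.2
  have hKpos : ∀ x ∈ Ioo 0 t₀, 0 < K x := by
    intro x hx
    rw [hKm]
    refine mul_pos (Real.rpow_pos_of_pos hx.1 _) ?_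
    by_contra! h
    exact absurd (csInf_le hSb (⟨hx.1.le, h⟩ : x ∈ S)) (not_le.2 hx.2)
  -- The window `[t₁, t₀]` is so short that the contribution of `(t, t₀)` cannot balance `k(t₀)` for
  -- any `t` in it; `t₁ > t₀ / 2` keeps `k(t)` bounded by `k(t₀ / 2)`.
  obtain ⟨t₁, ht₁, hsmall⟩ : ∃ t₁ ∈ Ioo (t₀ / 2) t₀,
      lam * powKernel (α + 1) (t₀ - t₁) * powKernel α (t₀ / 2) < powKernel α t₀ := by
    have hc : ContinuousAt (fun t => lam * powKernel (α + 1) (t₀ - t) * powKernel α (t₀ / 2)) t₀ := by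
      have : Continuous fun t : ℝ => (t₀ - t) ^ (α + 1 - 1) :=
        (Real.continuous_rpow_const (by linarith)).comp (continuous_const.sub continuous_id)
      simp only [powKernel]
      exact ((continuous_const.mul (continuous_const.mul this)).mul continuous_const).continuousAt
    have hlt : lam * powKernel (α + 1) (t₀ - t₀) * powKernel α (t₀ / 2) < powKernel α t₀ := by
      have : powKernel (α + 1) (t₀ - t₀) = 0 := by simp [powKernel, hα0.ne']
      rw [this, mul_zero, zero_mul]
      exact powKernel_pos hα0 h0
    have h1 := (hc.eventually_lt continuousAt_const hlt).filter_mono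
      (nhdsWithin_le_nhds (s := Iio t₀))
    have h2 : ∀ᶠ t in 𝓝[<] t₀, t ∈ Ioo (t₀ / 2) t₀ := Ioo_mem_nhdsLT (by linarith)
    obtain ⟨t, hta, htb⟩ := (h2.and h1).exists
    exact ⟨t, hta, htb⟩
  -- Taking `t` as a maximum point of `K` on the window ensures `K ≤ K t` on all of `[t, t₀]`, so `K
  -- t` can be cancelled at the end.
  obtain ⟨t, htI, hmax⟩ := isCompact_Icc.exists_isMaxOn (nonempty_Icc.2 ht₁.2.le)
    ((continuousOn_resolventKernel hα0 hα1 lam).mono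
      (fun x (hx : x ∈ Icc t₁ t₀) => show 0 < x by linarith [ht₁.1, hx.1]))
  have hKt : 0 < K t := (hKpos t₁ ⟨by linarith [ht₁.1], ht₁.2⟩).trans_le
    (hmax (left_mem_Icc.2 ht₁.2.le))
  have htt₀ : t < t₀ := lt_of_le_of_ne htI.2 fun h => by rw [h] at hKt; linarith
  have ht0 : 0 < t := by linarith [ht₁.1, htI.1]
  have hkt := powKernel_pos hα0 ht0
  have hsplit : ∫ s in Ioo 0 t₀, K s * powKernel α (t₀ - s)
      = (∫ s in Ioo 0 t, K s * powKernel α (t₀ - s))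
        + ∫ s in Ioo t t₀, K s * powKernel α (t₀ - s) := by
    have h1 := (intervalIntegrable_iff_integrableOn_Ioo_of_le h0.le).2 (hKint t₀ h0)
    have h2 := intervalIntegral.integral_add_adjacent_intervals
      (h1.mono_set (c := 0) (d := t) (by
        rw [uIcc_of_le ht0.le, uIcc_of_le h0.le]; exact Icc_subset_Icc_right htt₀.le))
      (h1.mono_set (c := t) (d := t₀) (by
        rw [uIcc_of_le htt₀.le, uIcc_of_le h0.le]; exact Icc_subset_Icc_left ht0.le))
    simp only [intervalIntegral.integral_of_le h0.le, intervalIntegral.integral_of_le ht0.le,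
      intervalIntegral.integral_of_le htt₀.le, integral_Ioc_eq_integral_Ioo] at h2
    exact h2.symm
  have hA : (∫ s in Ioo 0 t, K s * powKernel α (t₀ - s)) * powKernel α t
      ≤ powKernel α t₀ * ∫ s in Ioo 0 t, K s * powKernel α (t - s) := by
    rw [← integral_mul_const, ← integral_const_mul]
    refine setIntegral_mono_on (((hKint t₀ h0).mono_set (Ioo_subset_Ioo_right htt₀.le)).mul_const _)
      ((hKint t ht0).const_mul _) measurableSet_Ioo fun s hs => ?_
    have h1 := powKernel_mul_le hα0 hα1 hs.1 hs.2 htt₀.le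
    have h2 := hKpos s ⟨hs.1, hs.2.trans htt₀⟩
    nlinarith
  have hB : ∫ s in Ioo t t₀, K s * powKernel α (t₀ - s) ≤ K t * powKernel (α + 1) (t₀ - t) := by
    rw [← integral_powKernel hα0 htt₀, ← integral_const_mul]
    refine setIntegral_mono_on ((hKint t₀ h0).mono_set (Ioo_subset_Ioo_left ht0.le))
      ((integrableOn_powKernel hα0).const_mul _) measurableSet_Ioo fun s hs => ?_
    exact mul_le_mul_of_nonneg_right (hmax ⟨htI.1.trans hs.1.le, hs.2.le⟩)
      (powKernel_nonneg hα0 (by linarith [hs.2]))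
  have hV0 := hVol t₀ h0
  have hVt := hVol t ht0
  rw [hsplit] at hV0
  have hP : powKernel (α + 1) (t₀ - t) ≤ powKernel (α + 1) (t₀ - t₁) :=
    mul_le_mul_of_nonneg_left (Real.rpow_le_rpow (by linarith) (by linarith [htI.1]) (by linarith))
      (inv_pos.2 (Real.Gamma_pos_of_pos (by linarith))).le
  have hk2 : powKernel α t ≤ powKernel α (t₀ / 2) :=
    powKernel_antitone hα0 hα1 (by linarith) (by linarith [ht₁.1, htI.1])
  have hP0 : 0 ≤ powKernel (α + 1) (t₀ - t) := powKernel_nonneg (by linarith) (by linarith)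
  have hk0 := powKernel_pos hα0 h0
  set X := ∫ s in Ioo 0 t, K s * powKernel α (t₀ - s)
  set Y := ∫ s in Ioo t t₀, K s * powKernel α (t₀ - s)
  set Z := ∫ s in Ioo 0 t, K s * powKernel α (t - s)
  have h1 : lam * (X * powKernel α t) ≤ powKernel α t₀ * (powKernel α t - K t) := by
    rw [← hVt]
    nlinarith
  have h2 : lam * Y * powKernel α t ≤ lam * (K t * powKernel (α + 1) (t₀ - t)) * powKernel α t := by
    gcongr
  have h3 : powKernel α t₀ * powKernel α t ≤ lam * (X + Y) * powKernel α t := by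
    rw [hV0]
    gcongr
    linarith
  have h4 : powKernel α t₀ * K t ≤ (lam * powKernel (α + 1) (t₀ - t) * powKernel α t) * K t := by
    nlinarith
  have h5 := le_of_mul_le_mul_right h4 hKt
  have h6 : lam * powKernel (α + 1) (t₀ - t) * powKernel α t
      ≤ lam * powKernel (α + 1) (t₀ - t₁) * powKernel α (t₀ / 2) := by
    gcongr
    exact mul_nonneg hl.le (hP0.trans hP)
  linarith

/-- The continuous Mittag-Leffler factor attains its minimum on `[0, t]`. This is positive: at `0`
the value is `1 / Γ(α)`, elsewhere positivity of the kernel applies. Integrability against `K`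
therefore implies integrability against `k`. -/
theorem exists_le_resolventKernel (hα0 : 0 < α) (hα1 : α < 1) (lam : ℝ) {t : ℝ} (ht : 0 < t) :
    ∃ c : ℝ, 0 < c ∧ ∀ r ∈ Ioc 0 t, c * powKernel α r ≤ resolventKernel α lam r := by
  have hG := Real.Gamma_pos_of_pos hα0
  obtain ⟨x, hx, hmin⟩ := (isCompact_Icc (a := 0) (b := t)).exists_isMinOn (nonempty_Icc.2 ht.le)
    (continuous_mittagLeffler_rpow hα0 hα1 lam).continuousOn
  have hpos : 0 < mittagLeffler α α (-lam * x ^ α) := by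
    rcases hx.1.eq_or_lt with h | h
    · rw [← h, Real.zero_rpow hα0.ne', mul_zero, mittagLeffler_zero]
      exact inv_pos.2 hG
    · exact (mul_pos_iff_of_pos_left (Real.rpow_pos_of_pos h _)).1
        (resolventKernel_pos hα0 hα1 lam h)
  refine ⟨_, mul_pos hG hpos, fun r hr => ?_⟩
  rw [resolventKernel_eq hα0]
  have h2 := hmin (⟨hr.1.le, hr.2⟩ : r ∈ Icc 0 t)
  have h3 := powKernel_pos hα0 hr.1
  simp only [mem_ofPred_eq] at h2
  gcongr

end Positivity

/-! ### The Caputo integral near and away from its singularity. -/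

section Caputo

variable {α : ℝ} {X : Type*} [NormedAddCommGroup X] [NormedSpace ℝ X]

/-- The Lipschitz bound absorbs one power of `t - s` and leaves the integrable singularity `(t -
s)^(-α)`. -/
theorem integrableOn_caputo_near {v : ℝ → X} {ε t M : ℝ} (hα0 : 0 < α) (hα1 : α < 1)
    (hm : AEStronglyMeasurable v (volume.restrict (Ioo ε t)))
    (hL : ∀ s ∈ Ioo ε t, ‖v t - v s‖ ≤ M * (t - s)) :
    IntegrableOn (fun s => (α * (t - s) ^ (-α - 1)) • (v t - v s)) (Ioo ε t) := by
  have hd : IntegrableOn (fun s => (α * M * Real.Gamma (1 - α)) * powKernel (1 - α) (t - s))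
      (Ioo ε t) := (integrableOn_powKernel (by linarith)).const_mul _
  refine hd.mono' (AEStronglyMeasurable.smul (Measurable.aestronglyMeasurable (by fun_prop))
    (aestronglyMeasurable_const.sub hm)) ?_
  filter_upwards [ae_restrict_mem measurableSet_Ioo] with s hs
  have hts : 0 < t - s := by linarith [hs.2]
  have hG := (Real.Gamma_pos_of_pos (by linarith : 0 < 1 - α)).ne'
  have hr : (t - s) ^ (1 - α - 1) = (t - s) ^ (-α - 1) * (t - s) := by
    rw [← Real.rpow_add_one hts.ne']
    congr 1
    ring
  rw [norm_smul, Real.norm_of_nonneg (by positivity), powKernel, hr]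
  calc α * (t - s) ^ (-α - 1) * ‖v t - v s‖ ≤ α * (t - s) ^ (-α - 1) * (M * (t - s)) := by
        gcongr
        exact hL s hs
    _ = _ := by field_simp

theorem integrableOn_caputo_far {v : ℝ → X} {ε t : ℝ} (α : ℝ) (hεt : ε < t) (x : X)
    (hv : IntegrableOn v (Ioo 0 ε)) :
    IntegrableOn (fun s => (α * (t - s) ^ (-α - 1)) • (x - v s)) (Ioo 0 ε) := by
  have hc : ContinuousOn (fun s : ℝ => α * (t - s) ^ (-α - 1)) (Icc 0 ε) := by
    intro s hs
    exact (continuousAt_const.mul ((continuousAt_const.sub continuousAt_id).rpow_const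
      (Or.inl (by simp; linarith [hs.2])))).continuousWithinAt
  have hv2 : IntegrableOn (fun s => x - v s) (Icc 0 ε) := by
    rw [integrableOn_Icc_iff_integrableOn_Ioo]
    exact Integrable.sub (integrable_const x) hv
  exact (hv2.continuousOn_smul hc isCompact_Icc).mono_set Ioo_subset_Icc_self

theorem intervalIntegrable_caputo {v : ℝ → X} {ε t M : ℝ} (hα0 : 0 < α) (hα1 : α < 1)
    (hε : 0 < ε) (hεt : ε < t) (hv : IntegrableOn v (Ioo 0 t))
    (hL : ∀ s ∈ Ioo ε t, ‖v t - v s‖ ≤ M * (t - s)) :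
    IntervalIntegrable (fun s => (α * (t - s) ^ (-α - 1)) • (v t - v s)) volume 0 t := by
  have h1 := integrableOn_caputo_far α hεt (v t) (hv.mono_set (Ioo_subset_Ioo_right hεt.le))
  have h2 := integrableOn_caputo_near hα0 hα1
    (hv.mono_set (Ioo_subset_Ioo_left hε.le)).aestronglyMeasurable hL
  exact ((intervalIntegrable_iff_integrableOn_Ioo_of_le hε.le).2 h1).trans
    ((intervalIntegrable_iff_integrableOn_Ioo_of_le hεt.le).2 h2)

/-- The Caputo derivative at time `τ` splits at a time `ε < τ` into the fractional integral of the
time derivative on `(ε, τ)` and a history term. -/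
theorem caputo_split {w g : ℝ → ℝ} {ε τ M : ℝ} (hα0 : 0 < α) (hα1 : α < 1) (hε : 0 < ε)
    (hετ : ε < τ) (hw0 : w 0 = 0) (hw : IntegrableOn w (Ioo 0 τ))
    (hgm : AEStronglyMeasurable g (volume.restrict (Ioo ε τ)))
    (hgM : ∀ᵐ s ∂volume.restrict (Ioo ε τ), ‖g s‖ ≤ M)
    (hwL : ∀ s ∈ Ioo ε τ, ‖w τ - w s‖ ≤ M * (τ - s))
    (hwg : ∀ s ∈ Icc ε τ, w τ - w s = ∫ r in s..τ, g r) :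
    caputo α w τ = (∫ s in Ioo ε τ, powKernel (1 - α) (τ - s) * g s)
      + powKernel (1 - α) (τ - ε) * w ε
      - ∫ s in Ioo 0 ε, ((Real.Gamma (1 - α))⁻¹ * (α * (τ - s) ^ (-α - 1))) * w s := by
  have h1α : 0 < 1 - α := by linarith
  have hτε : 0 < τ - ε := by linarith
  have hwε := hw.mono_set (Ioo_subset_Ioo_right hετ.le)
  have hgI : IntegrableOn g (Ioo ε τ) :=
    (integrable_const (μ := volume.restrict (Ioo ε τ)) M).mono' hgm hgM
  have hkg : IntegrableOn (fun s => (τ - s) ^ (-α) * g s) (Ioo ε τ) := by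
    have h := ((integrableOn_powKernel (s := ε) (t := τ) h1α).const_mul (Real.Gamma (1 - α)))
    refine (h.mul_const M).mono' ((Measurable.aestronglyMeasurable (by fun_prop)).mul hgm) ?_
    filter_upwards [hgM, ae_restrict_mem measurableSet_Ioo] with s hs hsm
    have hG := (Real.Gamma_pos_of_pos h1α).ne'
    have h3 : 0 ≤ (τ - s) ^ (-α) := Real.rpow_nonneg (by linarith [hsm.2]) _
    rw [norm_mul, Real.norm_of_nonneg h3, powKernel, mul_inv_cancel_left₀ hG,
      show 1 - α - 1 = -α by ring]
    gcongr
  -- the known formula on `(ε, τ)`, shifted to `(0, τ - ε)`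
  have hshift := caputo_eq_fracInt (v := fun x => w (x + ε)) (g := fun x => g (x + ε)) hα0 hτε
    (by
      have := ((intervalIntegrable_iff_integrableOn_Ioo_of_le hετ.le).2 hgI).comp_add_right ε
      simpa using this)
    (by
      have := ((intervalIntegrable_iff_integrableOn_Ioo_of_le hετ.le).2 hkg).comp_add_right ε
      simp only [sub_self] at this
      refine this.congr fun s _ => ?_
      simp only [smul_eq_mul]
      congr 2
      ring)
    (by
      intro s hs
      have h := hwg (s + ε) ⟨by linarith [hs.1], by linarith [hs.2]⟩
      rw [sub_add_cancel, h, intervalIntegral.integral_comp_add_right, sub_add_cancel])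
  have hR : fracInt (1 - α) (fun x => g (x + ε)) (τ - ε)
      = ∫ s in Ioo ε τ, powKernel (1 - α) (τ - s) * g s := by
    have h := intervalIntegral.integral_comp_add_right (a := 0) (b := τ - ε)
      (fun s => (τ - s) ^ (1 - α - 1) * g s) ε
    rw [zero_add, sub_add_cancel, intervalIntegral.integral_of_le hετ.le,
      integral_Ioc_eq_integral_Ioo] at h
    have e : ∀ x, τ - (x + ε) = τ - ε - x := fun x => by ring
    simp only [e] at h
    simp only [fracInt, smul_eq_mul, h, powKernel, mul_assoc, integral_const_mul]
  have hLs : caputo α (fun x => w (x + ε)) (τ - ε) = (Real.Gamma (1 - α))⁻¹ *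
      ((τ - ε) ^ (-α) * (w τ - w ε)
        + ∫ s in Ioo ε τ, (α * (τ - s) ^ (-α - 1)) * (w τ - w s)) := by
    have h := intervalIntegral.integral_comp_add_right (a := 0) (b := τ - ε)
      (fun s => (α * (τ - s) ^ (-α - 1)) * (w τ - w s)) ε
    rw [zero_add, sub_add_cancel, intervalIntegral.integral_of_le hετ.le,
      integral_Ioc_eq_integral_Ioo] at h
    have e : ∀ x, τ - (x + ε) = τ - ε - x := fun x => by ring
    simp only [e] at h
    simp only [caputo, smul_eq_mul, sub_add_cancel, zero_add, h]
  have hnear := integrableOn_caputo_near hα0 hα1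
    (hw.mono_set (Ioo_subset_Ioo_left hε.le)).aestronglyMeasurable hwL
  have hfar := integrableOn_caputo_far α hετ (w τ) hwε
  have hsplit := intervalIntegral.integral_add_adjacent_intervals
    ((intervalIntegrable_iff_integrableOn_Ioo_of_le hε.le).2 hfar)
    ((intervalIntegrable_iff_integrableOn_Ioo_of_le hετ.le).2 hnear)
  have hker := integral_caputo_weight (α := α) hετ hε.le
  have hfc := integrableOn_caputo_far α hετ 1 (v := fun _ => (0 : ℝ)) (integrable_zero _ _ _)
  have hfw := integrableOn_caputo_far α hετ 0 hwε
  -- The constant part of the history integral equals `w τ ((τ - ε)^(-α) - τ^(-α))`. It cancels the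
  -- boundary term at time `0` and replaces it by one at time `ε`.
  have hfar2 : ∫ s in Ioo 0 ε, (α * (τ - s) ^ (-α - 1)) * (w τ - w s)
      = w τ * ((τ - ε) ^ (-α) - τ ^ (-α)) - ∫ s in Ioo 0 ε, (α * (τ - s) ^ (-α - 1)) * w s := by
    rw [intervalIntegral.integral_of_le hε.le, integral_Ioc_eq_integral_Ioo] at hker
    simp only [smul_eq_mul, sub_zero, mul_one, zero_sub, mul_neg] at hfc hfw
    rw [← hker, ← integral_const_mul, ← integral_sub (hfc.const_mul _) (integrable_neg_iff.1 hfw)]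
    congr 1
    ext s
    ring
  rw [intervalIntegral.integral_of_le hε.le, intervalIntegral.integral_of_le hετ.le,
    integral_Ioc_eq_integral_Ioo, integral_Ioc_eq_integral_Ioo] at hsplit
  simp only [smul_eq_mul] at hsplit
  rw [← hR, ← hshift, hLs]
  simp only [caputo, smul_eq_mul, hw0, sub_zero, powKernel]
  rw [← hsplit, hfar2, show 1 - α - 1 = -α by ring]
  simp only [mul_assoc, integral_const_mul]
  ring

end Caputo

/-! ### The regularity class: bounded, and Lipschitz away from time `0`. -/

/-- `v` is integrable and essentially bounded on `(0, t)`, and Lipschitz on `[ε, t]` for every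
`ε ∈ (0, t)`. -/
structure LocLipschitz {X : Type*} [NormedAddCommGroup X] (t : ℝ) (v : ℝ → X) : Prop where
  integrableOn : IntegrableOn v (Ioo 0 t)
  bounded : ∃ M, ∀ᵐ s ∂volume.restrict (Ioo 0 t), ‖v s‖ ≤ M
  lipschitz : ∀ ε ∈ Ioo 0 t, ∃ M, ∀ s ∈ Icc ε t, ∀ r ∈ Icc ε t, ‖v r - v s‖ ≤ M * |r - s|

namespace LocLipschitz

variable {X : Type*} [NormedAddCommGroup X] {t : ℝ} {v v' : ℝ → X}

theorem mono (h : LocLipschitz t v) {t' : ℝ} (ht : t' ≤ t) : LocLipschitz t' v where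
  integrableOn := h.integrableOn.mono_set (Ioo_subset_Ioo_right ht)
  bounded := by
    obtain ⟨M, hM⟩ := h.bounded
    exact ⟨M, ae_restrict_of_ae_restrict_of_subset (Ioo_subset_Ioo_right ht) hM⟩
  lipschitz ε hε := by
    obtain ⟨M, hM⟩ := h.lipschitz ε ⟨hε.1, hε.2.trans_le ht⟩
    exact ⟨M, fun s hs r hr => hM s ⟨hs.1, hs.2.trans ht⟩ r ⟨hr.1, hr.2.trans ht⟩⟩

theorem norm (h : LocLipschitz t v) : LocLipschitz t fun s => ‖v s‖ where
  integrableOn := h.integrableOn.norm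
  bounded := by simpa using h.bounded
  lipschitz ε hε := by
    obtain ⟨M, hM⟩ := h.lipschitz ε hε
    exact ⟨M, fun s hs r hr => (abs_norm_sub_norm_le _ _).trans (hM s hs r hr)⟩

theorem sub (h : LocLipschitz t v) (h' : LocLipschitz t v') :
    LocLipschitz t fun s => v s - v' s where
  integrableOn := h.integrableOn.sub h'.integrableOn
  bounded := by
    obtain ⟨M, hM⟩ := h.bounded
    obtain ⟨M', hM'⟩ := h'.bounded
    refine ⟨M + M', ?_⟩
    filter_upwards [hM, hM'] with s h1 h2
    exact (norm_sub_le _ _).trans (add_le_add h1 h2)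
  lipschitz ε hε := by
    obtain ⟨M, hM⟩ := h.lipschitz ε hε
    obtain ⟨M', hM'⟩ := h'.lipschitz ε hε
    refine ⟨M + M', fun s hs r hr => ?_⟩
    rw [sub_sub_sub_comm, add_mul]
    exact (norm_sub_le _ _).trans (add_le_add (hM s hs r hr) (hM' s hs r hr))

theorem intervalIntegrable_caputo [NormedSpace ℝ X] {α : ℝ} (hα0 : 0 < α) (hα1 : α < 1)
    (h : LocLipschitz t v) (ht : 0 < t) :
    IntervalIntegrable (fun s => (α * (t - s) ^ (-α - 1)) • (v t - v s)) volume 0 t := by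
  obtain ⟨M, hM⟩ := h.lipschitz (t / 2) ⟨by linarith, by linarith⟩
  refine _root_.intervalIntegrable_caputo hα0 hα1 (by linarith : 0 < t / 2) (by linarith)
    h.integrableOn (M := M) fun s hs => ?_
  have := hM s ⟨hs.1.le, hs.2.le⟩ t ⟨by linarith, le_rfl⟩
  rwa [abs_of_nonneg (by linarith [hs.2])] at this

/-- A Lipschitz function has a bounded derivative of which it is a primitive. -/
theorem exists_deriv {w : ℝ → ℝ} (h : LocLipschitz t w) {ε : ℝ} (hε : ε ∈ Ioo 0 t) :
    ∃ g : ℝ → ℝ, ∃ M : ℝ, AEStronglyMeasurable g (volume.restrict (Ioo ε t)) ∧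
      (∀ s ∈ Ioo ε t, ‖g s‖ ≤ M) ∧
      (∀ s ∈ Icc ε t, ∀ r ∈ Icc ε t, ‖w r - w s‖ ≤ M * |r - s|) ∧
      ∀ s ∈ Icc ε t, ∀ r ∈ Icc ε t, w r - w s = ∫ x in s..r, g x := by
  obtain ⟨M, hM⟩ := h.lipschitz ε hε
  have hL : LipschitzOnWith (Real.toNNReal M) w (Icc ε t) := by
    refine LipschitzOnWith.of_dist_le_mul fun x hx y hy => ?_
    rw [Real.dist_eq, Real.dist_eq]
    refine (hM y hy x hx).trans ?_
    gcongr
    exact Real.le_coe_toNNReal M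
  refine ⟨deriv w, Real.toNNReal M, (measurable_deriv w).aestronglyMeasurable, ?_, ?_, ?_⟩
  · intro s hs
    exact norm_deriv_le_of_lipschitzOn (Icc_mem_nhds hs.1 hs.2) hL
  · intro s hs r hr
    exact hL.dist_le_mul r hr s hs
  · intro s hs r hr
    have hac := (hL.mono (s := uIcc s r) (by
      rw [← uIcc_of_le hε.2.le] at hs hr ⊢
      exact uIcc_subset_uIcc hs hr)).absolutelyContinuousOnInterval
    exact hac.integral_deriv_eq_sub.symm

end LocLipschitz

/-! ### Inversion of the Caputo derivative on `(ε, t)`. -/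

section Inversion

variable {α : ℝ} {w : ℝ → ℝ} {t : ℝ}

theorem integral_caputo_kernel (α : ℝ) {ε τ : ℝ} (hε : 0 < ε) (hετ : ε < τ) :
    IntegrableOn (fun s => (Real.Gamma (1 - α))⁻¹ * (α * (τ - s) ^ (-α - 1))) (Ioo 0 ε) ∧
    ∫ s in Ioo 0 ε, (Real.Gamma (1 - α))⁻¹ * (α * (τ - s) ^ (-α - 1))
      = powKernel (1 - α) (τ - ε) - powKernel (1 - α) τ := by
  constructor
  · have h := integrableOn_caputo_far α hετ (1 : ℝ) (v := fun _ => 0) (integrable_zero _ _ _)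
    simp only [smul_eq_mul, sub_zero, mul_one] at h
    exact h.const_mul _
  · have h := integral_caputo_weight (α := α) hετ hε.le
    rw [intervalIntegral.integral_of_le hε.le, integral_Ioc_eq_integral_Ioo] at h
    rw [integral_const_mul, h, powKernel, powKernel, show 1 - α - 1 = -α by ring]
    ring

/-- Apply `J^α` to the three terms of `caputo_split`. As `powKernel α * powKernel (1 - α) = 1`, the
derivative term gives `w t - w ε` and the boundary term gives `w ε`. Only the history term is left,
and it is controlled by the bound `M` alone, uniformly in the Lipschitz constants, which may blow up
as `ε → 0`. -/
theorem abs_sub_integral_caputo_le (hα0 : 0 < α) (hα1 : α < 1) (hw : LocLipschitz t w)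
    (hw0 : w 0 = 0) {M ε : ℝ} (hM : ∀ᵐ s ∂volume.restrict (Ioo 0 t), ‖w s‖ ≤ M)
    (hε : ε ∈ Ioo 0 t) :
    IntegrableOn (fun τ => powKernel α (t - τ) * caputo α w τ) (Ioo ε t) ∧
    |w t - ∫ τ in Ioo ε t, powKernel α (t - τ) * caputo α w τ|
      ≤ M * ∫ τ in Ioo 0 ε, powKernel α (t - τ) * powKernel (1 - α) τ := by
  have h1α : 0 < 1 - α := by linarith
  have ht : 0 < t := hε.1.trans hε.2
  obtain ⟨g, N, hgm, hgN, hwL, hwg⟩ := hw.exists_deriv hε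
  have hgI : IntegrableOn g (Ioo ε t) :=
    (integrable_const (μ := volume.restrict (Ioo ε t)) N).mono' hgm
      ((ae_restrict_mem measurableSet_Ioo).mono hgN)
  have hone : α + (1 - α) = 1 := by ring
  have hkp : ∀ s < t, ∫ τ in Ioo s t, powKernel α (t - τ) * powKernel (1 - α) (τ - s) = 1 := by
    intro s hs
    rw [integral_powKernel_mul hα0 h1α hs, hone, powKernel_one]
  -- `Θ = 1` is exact here: the two kernels are nonnegative and their convolution is `1`.
  obtain ⟨-, hAint, hAval⟩ := volterra_assoc (a := ε) (t := t) (h := g) (Θ := fun _ => 1)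
    (measurable_powKernel α) (measurable_powKernel (1 - α)) hgm
    (fun s hs => integrableOn_powKernel_mul hα0 h1α hs.2)
    (fun s hs => by
      exact ((setIntegral_congr_fun measurableSet_Ioo fun τ hτ => abs_of_nonneg
        (mul_nonneg (powKernel_nonneg hα0 (sub_pos.2 hτ.2).le)
          (powKernel_nonneg h1α (sub_pos.2 hτ.1).le))).trans (hkp s hs.2)).le)
    (by simpa using hgI)
  have hAval2 : ∫ s in Ioo ε t, (∫ τ in Ioo s t, powKernel α (t - τ) * powKernel (1 - α) (τ - s))
      * g s = w t - w ε := by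
    rw [hwg ε ⟨le_rfl, hε.2.le⟩ t ⟨hε.2.le, le_rfl⟩, intervalIntegral.integral_of_le hε.2.le,
      integral_Ioc_eq_integral_Ioo]
    refine setIntegral_congr_fun measurableSet_Ioo fun s hs => ?_
    simp only [hkp s hs.2, one_mul]
  have hBint := (integrableOn_powKernel_mul hα0 h1α hε.2).mul_const (w ε)
  have hBval : ∫ τ in Ioo ε t, powKernel α (t - τ) * powKernel (1 - α) (τ - ε) * w ε = w ε := by
    rw [integral_mul_const, hkp ε hε.2, one_mul]
  -- the history term
  set P : ℝ → ℝ := fun τ =>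
    ∫ s in Ioo 0 ε, ((Real.Gamma (1 - α))⁻¹ * (α * (τ - s) ^ (-α - 1))) * w s with hP
  have hMε : ∀ᵐ s ∂volume.restrict (Ioo 0 ε), ‖w s‖ ≤ M :=
    ae_restrict_of_ae_restrict_of_subset (Ioo_subset_Ioo_right hε.2.le) hM
  have hPm : AEStronglyMeasurable P (volume.restrict (Ioo ε t)) := by
    have h : AEStronglyMeasurable (fun p : ℝ × ℝ =>
        ((Real.Gamma (1 - α))⁻¹ * (α * (p.1 - p.2) ^ (-α - 1))) * w p.2)
        ((volume.restrict (Ioo ε t)).prod (volume.restrict (Ioo 0 ε))) :=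
      AEStronglyMeasurable.mul (Measurable.aestronglyMeasurable (by fun_prop))
        (hw.integrableOn.mono_set (Ioo_subset_Ioo_right hε.2.le)).aestronglyMeasurable.comp_snd
    exact h.integral_prod_right'
  have hPle : ∀ τ ∈ Ioo ε t, |P τ| ≤ M * (powKernel (1 - α) (τ - ε) - powKernel (1 - α) τ) := by
    intro τ hτ
    obtain ⟨h1, h2⟩ := integral_caputo_kernel α hε.1 hτ.1
    rw [← h2, ← integral_const_mul, ← Real.norm_eq_abs]
    refine norm_integral_le_of_norm_le (h1.const_mul M) ?_
    filter_upwards [hMε, ae_restrict_mem measurableSet_Ioo] with s hs hsm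
    have h3 : 0 ≤ (Real.Gamma (1 - α))⁻¹ * (α * (τ - s) ^ (-α - 1)) :=
      mul_nonneg (inv_pos.2 (Real.Gamma_pos_of_pos h1α)).le
        (mul_nonneg hα0.le (Real.rpow_nonneg (by linarith [hsm.2, hτ.1]) _))
    rw [norm_mul, Real.norm_of_nonneg h3, mul_comm]
    gcongr
  have hk0 := (integrableOn_powKernel_mul hα0 h1α ht)
  simp only [sub_zero] at hk0
  have hkε := hk0.mono_set (Ioo_subset_Ioo_left (b := t) hε.1.le)
  have hdom : IntegrableOn (fun τ => M * (powKernel α (t - τ) * powKernel (1 - α) (τ - ε)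
      - powKernel α (t - τ) * powKernel (1 - α) τ)) (Ioo ε t) :=
    ((integrableOn_powKernel_mul hα0 h1α hε.2).sub hkε).const_mul M
  have hCle : ∀ᵐ τ ∂volume.restrict (Ioo ε t), ‖powKernel α (t - τ) * P τ‖
      ≤ M * (powKernel α (t - τ) * powKernel (1 - α) (τ - ε)
      - powKernel α (t - τ) * powKernel (1 - α) τ) := by
    filter_upwards [ae_restrict_mem measurableSet_Ioo] with τ hτ
    have h1 := powKernel_nonneg hα0 (by linarith [hτ.2] : 0 ≤ t - τ)
    rw [norm_mul, Real.norm_of_nonneg h1, ← mul_sub, mul_left_comm]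
    exact mul_le_mul_of_nonneg_left (hPle τ hτ) h1
  have hkm : AEStronglyMeasurable (fun τ => powKernel α (t - τ)) (volume.restrict (Ioo ε t)) :=
    (integrableOn_powKernel hα0).aestronglyMeasurable
  have hCint : IntegrableOn (fun τ => powKernel α (t - τ) * P τ) (Ioo ε t) :=
    hdom.mono' (hkm.mul hPm) hCle
  -- The dominating function integrates to `M` times `1 - ∫` of `powKernel α (t - τ) * powKernel (1
  -- - α) τ` over `(ε, t)`. Over all of `(0, t)` this product integrates to `1`, so the piece over
  -- `(0, ε)` remains.
  have hCval : |∫ τ in Ioo ε t, powKernel α (t - τ) * P τ|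
      ≤ M * ∫ τ in Ioo 0 ε, powKernel α (t - τ) * powKernel (1 - α) τ := by
    refine (norm_integral_le_of_norm_le hdom hCle).trans_eq ?_
    rw [integral_const_mul, integral_sub (integrableOn_powKernel_mul hα0 h1α hε.2) hkε,
      hkp ε hε.2]
    have h := hkp 0 ht
    simp only [sub_zero] at h
    have h2 := intervalIntegral.integral_add_adjacent_intervals
      ((intervalIntegrable_iff_integrableOn_Ioo_of_le hε.1.le).2
        (hk0.mono_set (Ioo_subset_Ioo_right hε.2.le)))
      ((intervalIntegrable_iff_integrableOn_Ioo_of_le hε.2.le).2 hkε)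
    simp only [intervalIntegral.integral_of_le hε.1.le, intervalIntegral.integral_of_le hε.2.le,
      intervalIntegral.integral_of_le ht.le, integral_Ioc_eq_integral_Ioo] at h2
    linear_combination (-M) * h - M * h2
  have hrep : ∀ τ ∈ Ioo ε t, powKernel α (t - τ) * caputo α w τ
      = (∫ s in Ioo ε τ, powKernel α (t - τ) * powKernel (1 - α) (τ - s) * g s)
        + powKernel α (t - τ) * powKernel (1 - α) (τ - ε) * w ε - powKernel α (t - τ) * P τ := by
    intro τ hτ
    have hsub : Ioo ε τ ⊆ Ioo ε t := Ioo_subset_Ioo_right hτ.2.le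
    rw [caputo_split (M := N) (g := g) hα0 hα1 hε.1 hτ.1 hw0
      (hw.integrableOn.mono_set (Ioo_subset_Ioo_right hτ.2.le)) (hgm.mono_set hsub)
      ((ae_restrict_mem measurableSet_Ioo).mono fun s hs => hgN s (hsub hs))
      (fun s hs => by
        have := hwL s ⟨hs.1.le, hs.2.le.trans hτ.2.le⟩ τ ⟨hτ.1.le, hτ.2.le⟩
        rwa [abs_of_nonneg (by linarith [hs.2])] at this)
      (fun s hs => hwg s ⟨hs.1, hs.2.trans hτ.2.le⟩ τ ⟨hτ.1.le, hτ.2.le⟩)]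
    simp only [mul_assoc, integral_const_mul, hP]
    ring
  have hAB : IntegrableOn (fun τ =>
      (∫ s in Ioo ε τ, powKernel α (t - τ) * powKernel (1 - α) (τ - s) * g s)
        + powKernel α (t - τ) * powKernel (1 - α) (τ - ε) * w ε) (Ioo ε t) := hAint.add hBint
  have hcongr : (fun τ => powKernel α (t - τ) * caputo α w τ) =ᵐ[volume.restrict (Ioo ε t)]
      fun τ => (∫ s in Ioo ε τ, powKernel α (t - τ) * powKernel (1 - α) (τ - s) * g s)
        + powKernel α (t - τ) * powKernel (1 - α) (τ - ε) * w ε - powKernel α (t - τ) * P τ :=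
    (ae_restrict_mem measurableSet_Ioo).mono hrep
  refine ⟨(hAB.sub hCint).congr hcongr.symm, ?_⟩
  rw [integral_congr_ae hcongr, integral_sub hAB hCint, integral_add hAint hBint,
    hAval, hAval2, hBval]
  simpa using hCval

end Inversion

/-! ### The comparison principle for `D^α + λ`. -/

section Comparison

variable {α : ℝ} {w : ℝ → ℝ} {t : ℝ}

/-- The shift by `2` keeps the cut-off times strictly below `t` already for `n = 0`. -/
theorem div_nat_add_two_mem_Ioo (ht : 0 < t) (n : ℕ) : t / (n + 2) ∈ Ioo 0 t :=
  ⟨by positivity, div_lt_self ht (by linarith [(Nat.cast_nonneg n : (0 : ℝ) ≤ n)])⟩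

theorem tendsto_div_nat_add_two (t : ℝ) : Tendsto (fun n : ℕ => t / ((n : ℝ) + 2)) atTop (𝓝 0) :=
  tendsto_const_nhds.div_atTop (tendsto_atTop_add_const_right _ _ tendsto_natCast_atTop_atTop)

theorem aecover_Ioo_div_nat (t : ℝ) : AECover (volume.restrict (Ioo 0 t)) atTop
    fun n : ℕ => Ioo (t / ((n : ℝ) + 2)) t :=
  aecover_Ioo_of_Ioo (tendsto_div_nat_add_two t) tendsto_const_nhds

theorem restrict_Ioo_restrict_Ioo (ht : 0 < t) (n : ℕ) :
    (volume.restrict (Ioo 0 t)).restrict (Ioo (t / ((n : ℝ) + 2)) t)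
      = volume.restrict (Ioo (t / ((n : ℝ) + 2)) t) :=
  Measure.restrict_restrict_of_subset (Ioo_subset_Ioo_left (div_nat_add_two_mem_Ioo ht n).1.le)

theorem aestronglyMeasurable_caputo (hα0 : 0 < α) (hα1 : α < 1) (hw : LocLipschitz t w)
    (hw0 : w 0 = 0) (ht : 0 < t) :
    AEStronglyMeasurable (caputo α w) (volume.restrict (Ioo 0 t)) := by
  obtain ⟨M, hM⟩ := hw.bounded
  have h1 : AEStronglyMeasurable (fun τ => powKernel α (t - τ) * caputo α w τ)
      (volume.restrict (Ioo 0 t)) := by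
    refine (aecover_Ioo_div_nat t).aestronglyMeasurable fun n => ?_
    rw [restrict_Ioo_restrict_Ioo ht]
    exact (abs_sub_integral_caputo_le hα0 hα1 hw hw0 hM
      (div_nat_add_two_mem_Ioo ht n)).1.aestronglyMeasurable
  have h2 : AEStronglyMeasurable (fun τ => (powKernel α (t - τ))⁻¹)
      (volume.restrict (Ioo 0 t)) := by
    have := measurable_powKernel α
    exact Measurable.aestronglyMeasurable (by fun_prop)
  refine (h2.mul h1).congr ?_
  filter_upwards [ae_restrict_mem measurableSet_Ioo] with τ hτ
  exact inv_mul_cancel_left₀ (powKernel_pos hα0 (sub_pos.2 hτ.2)).ne' _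

theorem tendsto_integral_caputo (hα0 : 0 < α) (hα1 : α < 1) (hw : LocLipschitz t w)
    (hw0 : w 0 = 0) (ht : 0 < t) :
    Tendsto (fun n : ℕ => ∫ τ in Ioo (t / ((n : ℝ) + 2)) t, powKernel α (t - τ) * caputo α w τ)
      atTop (𝓝 (w t)) := by
  obtain ⟨M, hM⟩ := hw.bounded
  have hk0 := (integrableOn_powKernel_mul hα0 (by linarith : 0 < 1 - α) ht)
  simp only [sub_zero] at hk0
  rw [← integrableOn_Icc_iff_integrableOn_Ioo, ← uIcc_of_le ht.le] at hk0
  have hc := intervalIntegral.continuousOn_primitive_interval hk0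
  have hlim := (hc 0 left_mem_uIcc).tendsto.comp (tendsto_nhdsWithin_iff.2
    ⟨tendsto_div_nat_add_two t, Eventually.of_forall fun n => by
      rw [uIcc_of_le ht.le]
      exact Ioo_subset_Icc_self (div_nat_add_two_mem_Ioo ht n)⟩)
  rw [intervalIntegral.integral_same] at hlim
  have hlim2 := hlim.const_mul M
  rw [mul_zero] at hlim2
  rw [tendsto_iff_dist_tendsto_zero]
  refine squeeze_zero (fun n => dist_nonneg) (fun n => ?_) hlim2
  have hn := div_nat_add_two_mem_Ioo ht n
  rw [dist_comm, Real.dist_eq]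
  refine (abs_sub_integral_caputo_le hα0 hα1 hw hw0 hM hn).2.trans_eq ?_
  simp only [Function.comp]
  rw [intervalIntegral.integral_of_le hn.1.le, integral_Ioc_eq_integral_Ioo]

/-- `w = J^α D^α w`, provided that `D^α w` is bounded above by an integrable function. -/
theorem integral_powKernel_mul_caputo (hα0 : 0 < α) (hα1 : α < 1) (hw : LocLipschitz t w)
    (hw0 : w 0 = 0) (ht : 0 < t) {D : ℝ → ℝ} (hD : IntegrableOn D (Ioo 0 t))
    (hle : ∀ τ ∈ Ioo 0 t, powKernel α (t - τ) * caputo α w τ ≤ D τ) :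
    IntegrableOn (fun τ => powKernel α (t - τ) * caputo α w τ) (Ioo 0 t) ∧
    ∫ τ in Ioo 0 t, powKernel α (t - τ) * caputo α w τ = w t := by
  obtain ⟨M, hM⟩ := hw.bounded
  have hcov := aecover_Ioo_div_nat t
  have hlim := tendsto_integral_caputo hα0 hα1 hw hw0 ht
  have hloc : ∀ n : ℕ, IntegrableOn (fun τ => powKernel α (t - τ) * caputo α w τ)
      (Ioo (t / ((n : ℝ) + 2)) t) := fun n =>
    (abs_sub_integral_caputo_le hα0 hα1 hw hw0 hM (div_nat_add_two_mem_Ioo ht n)).1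
  have hlimD := hcov.integral_tendsto_of_countably_generated hD
  simp only [restrict_Ioo_restrict_Ioo ht] at hlimD
  have hDn : ∀ n : ℕ, IntegrableOn D (Ioo (t / ((n : ℝ) + 2)) t) := fun n =>
    hD.mono_set (Ioo_subset_Ioo_left (div_nat_add_two_mem_Ioo ht n).1.le)
  -- The difference is nonnegative and its integrals over the exhausting intervals converge, hence
  -- are eventually bounded. A one-sided bound on the Caputo derivative thus already gives
  -- integrability on `(0, t)`.
  have hdiff : IntegrableOn (fun τ => D τ - powKernel α (t - τ) * caputo α w τ) (Ioo 0 t) := by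
    refine hcov.integrable_of_integral_bounded_of_nonneg_ae ((∫ τ in Ioo 0 t, D τ) - w t + 1)
      (fun n => ?_) ?_ ?_
    · rw [IntegrableOn, restrict_Ioo_restrict_Ioo ht]
      exact (hDn n).sub (hloc n)
    · filter_upwards [ae_restrict_mem measurableSet_Ioo] with τ hτ
      exact sub_nonneg.2 (hle τ hτ)
    · simp only [restrict_Ioo_restrict_Ioo ht]
      filter_upwards [(hlimD.sub hlim).eventually_le_const (lt_add_one _)] with n hn
      rwa [integral_sub (hDn n) (hloc n)]
  have hint : IntegrableOn (fun τ => powKernel α (t - τ) * caputo α w τ) (Ioo 0 t) :=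
    (Integrable.sub hD hdiff).congr (Eventually.of_forall fun τ => by simp)
  refine ⟨hint, ?_⟩
  have h := hcov.integral_tendsto_of_countably_generated hint
  simp only [restrict_Ioo_restrict_Ioo ht] at h
  exact tendsto_nhds_unique h hlim

/-- Since `|K| ≤ C k` and `k * k = powKernel (2α)`, which is `k` times a multiple of `r^α ≤ t^α`,
convolving with `K` costs only a constant. This provides the majorant `Θ` for Fubini. -/
theorem exists_integral_abs_resolventKernel_mul_le (hα0 : 0 < α) (hα1 : α < 1) (lam t : ℝ) :
    ∃ C : ℝ, ∀ s ∈ Ioo 0 t, ∫ τ in Ioo s t, |resolventKernel α lam (t - τ) * powKernel α (τ - s)|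
      ≤ C * powKernel α (t - s) := by
  obtain ⟨C, hC0, hC⟩ := exists_resolventKernel_le hα0 hα1 lam t
  have hG := Real.Gamma_pos_of_pos hα0
  have hG2 := Real.Gamma_pos_of_pos (by linarith : 0 < α + α)
  refine ⟨C * (Real.Gamma α * (Real.Gamma (α + α))⁻¹ * t ^ α), fun s hs => ?_⟩
  have hts : 0 < t - s := sub_pos.2 hs.2
  have h1 : ∫ τ in Ioo s t, |resolventKernel α lam (t - τ) * powKernel α (τ - s)|
      ≤ ∫ τ in Ioo s t, C * (powKernel α (t - τ) * powKernel α (τ - s)) := by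
    refine setIntegral_mono_on (integrableOn_resolventKernel_mul hα0 hα1 lam hα0 hs.2).abs
      ((integrableOn_powKernel_mul hα0 hα0 hs.2).const_mul C) measurableSet_Ioo fun τ hτ => ?_
    rw [abs_mul, abs_of_pos (powKernel_pos hα0 (sub_pos.2 hτ.1)), ← mul_assoc]
    exact mul_le_mul_of_nonneg_right (hC _ ⟨sub_pos.2 hτ.2, by linarith [hτ.1, hs.1]⟩)
      (powKernel_nonneg hα0 (sub_pos.2 hτ.1).le)
  refine h1.trans ?_
  rw [integral_const_mul, integral_powKernel_mul hα0 hα0 hs.2, mul_assoc]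
  refine mul_le_mul_of_nonneg_left ?_ hC0
  have h2 : (t - s) ^ (α + α - 1) = (t - s) ^ α * (t - s) ^ (α - 1) := by
    rw [← Real.rpow_add hts]
    congr 1
    ring
  have h3 : (t - s) ^ α ≤ t ^ α := Real.rpow_le_rpow hts.le (by linarith [hs.1]) hα0.le
  have h4 : 0 ≤ (t - s) ^ (α - 1) := Real.rpow_nonneg hts.le _
  rw [powKernel, powKernel, h2]
  calc (Real.Gamma (α + α))⁻¹ * ((t - s) ^ α * (t - s) ^ (α - 1))
      ≤ (Real.Gamma (α + α))⁻¹ * (t ^ α * (t - s) ^ (α - 1)) := by gcongr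
    _ = _ := by field_simp

/-- Variation of constants: `w ≤ (D^α + λ)⁻¹ G` if `(D^α + λ) w ≤ G`, `0 ≤ G` and `w 0 = 0`. -/
theorem le_integral_resolventKernel_mul (hα0 : 0 < α) (hα1 : α < 1) (lam : ℝ)
    (hw : LocLipschitz t w) (hw0 : w 0 = 0) (ht : 0 < t) {G : ℝ → ℝ} (hG0 : ∀ s ∈ Ioo 0 t, 0 ≤ G s)
    (hG : IntegrableOn (fun s => resolventKernel α lam (t - s) * G s) (Ioo 0 t))
    (hle : ∀ s ∈ Ioo 0 t, caputo α w s + lam * w s ≤ G s) :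
    w t ≤ ∫ s in Ioo 0 t, resolventKernel α lam (t - s) * G s := by
  set K := resolventKernel α lam with hK
  have hKm : Measurable K := measurable_resolventKernel hα0 hα1 lam
  have hkm := measurable_powKernel α
  have hKpos : ∀ {r}, 0 < r → 0 < K r := resolventKernel_pos hα0 hα1 lam
  obtain ⟨M, hM⟩ := hw.bounded
  obtain ⟨c, hc0, hc⟩ := exists_le_resolventKernel hα0 hα1 lam ht
  obtain ⟨C, hC0, hC⟩ := exists_resolventKernel_le hα0 hα1 lam t
  obtain ⟨C', hC'⟩ := exists_integral_abs_resolventKernel_mul_le hα0 hα1 lam t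
  have hmem : ∀ᵐ s ∂volume.restrict (Ioo 0 t), s ∈ Ioo 0 t := ae_restrict_mem measurableSet_Ioo
  have hGm : AEStronglyMeasurable G (volume.restrict (Ioo 0 t)) := by
    have h2 : AEStronglyMeasurable (fun τ => (K (t - τ))⁻¹) (volume.restrict (Ioo 0 t)) :=
      Measurable.aestronglyMeasurable (by fun_prop)
    refine (h2.mul hG.aestronglyMeasurable).congr ?_
    filter_upwards [hmem] with τ hτ
    exact inv_mul_cancel_left₀ (hKpos (sub_pos.2 hτ.2)).ne' _
  have hkG : IntegrableOn (fun s => powKernel α (t - s) * G s) (Ioo 0 t) := by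
    refine (hG.const_mul c⁻¹).mono' ((Measurable.aestronglyMeasurable (by fun_prop)).mul hGm) ?_
    filter_upwards [hmem] with s hs
    have h1 := hc (t - s) ⟨sub_pos.2 hs.2, by linarith [hs.1]⟩
    have h2 := powKernel_pos hα0 (sub_pos.2 hs.2)
    rw [norm_mul, Real.norm_of_nonneg h2.le, Real.norm_of_nonneg (hG0 s hs), ← mul_assoc]
    refine mul_le_mul_of_nonneg_right ?_ (hG0 s hs)
    rw [inv_mul_eq_div, le_div_iff₀ hc0]
    linarith
  -- products of weakly singular kernels and the bounded function `w`
  have hbw : ∀ s ∈ Ioc 0 t, IntegrableOn (fun τ => powKernel α (s - τ) * |w τ|) (Ioo 0 s) := by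
    intro s hs
    have hsub : Ioo 0 s ⊆ Ioo 0 t := Ioo_subset_Ioo_right hs.2
    refine ((integrableOn_powKernel hα0).mul_const M).mono'
      ((Measurable.aestronglyMeasurable (by fun_prop)).mul
        (hw.integrableOn.mono_set hsub).aestronglyMeasurable.norm) ?_
    filter_upwards [ae_restrict_of_ae_restrict_of_subset hsub hM,
      ae_restrict_mem measurableSet_Ioo] with τ h1 hτ
    have h2 := powKernel_pos hα0 (sub_pos.2 hτ.2)
    rw [norm_mul, Real.norm_of_nonneg h2.le, Real.norm_eq_abs, abs_abs, ← Real.norm_eq_abs]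
    gcongr
  -- The inversion formula is needed at the intermediate times too. There it requires `G` to be
  -- integrable against `powKernel α (s - ·)`, which is known only for `s = t` and, by Fubini below,
  -- for almost every `s`.
  have hinv : ∀ s ∈ Ioc 0 t, IntegrableOn (fun τ => powKernel α (s - τ) * G τ) (Ioo 0 s) →
      IntegrableOn (fun τ => powKernel α (s - τ) * caputo α w τ) (Ioo 0 s) ∧
      ∫ τ in Ioo 0 s, powKernel α (s - τ) * caputo α w τ = w s := by
    intro s hs hsG
    refine integral_powKernel_mul_caputo hα0 hα1 (hw.mono hs.2) hw0 hs.1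
      (Integrable.add hsG ((hbw s hs).const_mul |lam|)) fun τ hτ => ?_
    have h1 := hle τ ⟨hτ.1, hτ.2.trans_le hs.2⟩
    have h2 : -(lam * w τ) ≤ |lam| * |w τ| := by
      rw [← abs_mul]
      exact neg_le_abs _
    have h3 := powKernel_pos hα0 (sub_pos.2 hτ.2)
    simp only [Pi.add_apply]
    nlinarith
  obtain ⟨hkh, hwt⟩ := hinv t ⟨ht, le_rfl⟩ hkG
  set h := caputo α w with hh
  have hhm : AEStronglyMeasurable h (volume.restrict (Ioo 0 t)) :=
    aestronglyMeasurable_caputo hα0 hα1 hw hw0 ht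
  have hKk : ∀ s ∈ Ioo 0 t, IntegrableOn (fun τ => K (t - τ) * powKernel α (τ - s)) (Ioo s t) :=
    fun s hs => integrableOn_resolventKernel_mul hα0 hα1 lam hα0 hs.2
  have hkC : ∀ {f : ℝ → ℝ}, IntegrableOn (fun s => powKernel α (t - s) * f s) (Ioo 0 t) →
      IntegrableOn (fun s => C' * powKernel α (t - s) * f s) (Ioo 0 t) := by
    intro f hf
    simpa only [mul_assoc, IntegrableOn] using hf.const_mul C'
  obtain ⟨hae, -, -⟩ := volterra_assoc (Θ := fun r => C' * powKernel α r) hKm hkm hGm hKk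
    (fun s hs => hC' s hs) (hkC hkG)
  obtain ⟨-, -, hassoc⟩ := volterra_assoc (Θ := fun r => C' * powKernel α r) hKm hkm hhm hKk
    (fun s hs => hC' s hs) (hkC hkh)
  have hKle : ∀ {f : ℝ → ℝ}, IntegrableOn (fun s => powKernel α (t - s) * f s) (Ioo 0 t) →
      AEStronglyMeasurable f (volume.restrict (Ioo 0 t)) →
      IntegrableOn (fun s => K (t - s) * f s) (Ioo 0 t) := by
    intro f hf hfm
    refine (hf.norm.const_mul C).mono' ((Measurable.aestronglyMeasurable (by fun_prop)).mul hfm) ?_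
    filter_upwards [hmem] with s hs
    have h2 := powKernel_pos hα0 (sub_pos.2 hs.2)
    rw [norm_mul, norm_mul, Real.norm_of_nonneg h2.le, ← mul_assoc]
    exact mul_le_mul_of_nonneg_right (hC _ ⟨sub_pos.2 hs.2, by linarith [hs.1]⟩) (norm_nonneg _)
  have hKh : IntegrableOn (fun s => K (t - s) * h s) (Ioo 0 t) := hKle hkh hhm
  have hwm := hw.integrableOn.aestronglyMeasurable
  have hkw : IntegrableOn (fun s => powKernel α (t - s) * w s) (Ioo 0 t) := by
    refine (hbw t ⟨ht, le_rfl⟩).mono' ((Measurable.aestronglyMeasurable (by fun_prop)).mul hwm) ?_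
    filter_upwards [hmem] with s hs
    rw [norm_mul, Real.norm_of_nonneg (powKernel_nonneg hα0 (sub_pos.2 hs.2).le),
      Real.norm_eq_abs]
  have hKw : IntegrableOn (fun s => K (t - s) * w s) (Ioo 0 t) := hKle hkw hwm
  have hL : ∫ τ in Ioo 0 t, ∫ s in Ioo 0 τ, K (t - τ) * powKernel α (τ - s) * h s
      = ∫ τ in Ioo 0 t, K (t - τ) * w τ := by
    refine integral_congr_ae ?_
    filter_upwards [hae, hmem] with τ h1 hτ
    have h2 := (hKpos (sub_pos.2 hτ.2)).ne'
    have h3 : IntegrableOn (fun s => powKernel α (τ - s) * G s) (Ioo 0 τ) := by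
      refine (h1.const_mul (K (t - τ))⁻¹).congr (Eventually.of_forall fun s => ?_)
      simp only [mul_assoc]
      exact inv_mul_cancel_left₀ h2 _
    rw [← (hinv τ ⟨hτ.1, hτ.2.le⟩ h3).2, ← integral_const_mul]
    simp only [mul_assoc]
  -- The Volterra equation for the kernels, integrated against `h`.
  have hR : lam * ∫ s in Ioo 0 t, (∫ τ in Ioo s t, K (t - τ) * powKernel α (τ - s)) * h s
      = w t - ∫ s in Ioo 0 t, K (t - s) * h s := by
    rw [← hwt, ← integral_sub hkh hKh, ← integral_const_mul]
    refine setIntegral_congr_fun measurableSet_Ioo fun s hs => ?_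
    rw [← mul_assoc, lam_mul_integral_resolventKernel_mul hα0 hα1 lam hs.2, sub_mul]
  have hfin : w t = ∫ s in Ioo 0 t, K (t - s) * (h s + lam * w s) := by
    have e : ∀ s, K (t - s) * (h s + lam * w s) = K (t - s) * h s + lam * (K (t - s) * w s) :=
      fun s => by ring
    simp_rw [e]
    rw [integral_add hKh (hKw.const_mul lam), integral_const_mul, ← hL, hassoc, hR]
    ring
  rw [hfin]
  refine setIntegral_mono_on ?_ hG measurableSet_Ioo fun s hs =>
    mul_le_mul_of_nonneg_left (hle s hs) (hKpos (sub_pos.2 hs.2)).le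
  refine (Integrable.add hKh (hKw.const_mul lam)).congr (Eventually.of_forall fun s => ?_)
  simp only [Pi.add_apply]
  ring

/-- The comparison principle with values in `[0, ∞]`; the majorant need not be measurable. -/
theorem le_caputoResolventENN (hα0 : 0 < α) (hα1 : α < 1) (lam : ℝ)
    (hw : LocLipschitz t w) (hw0 : w 0 = 0) (ht : 0 < t) {r : ℝ → ℝ} (hr0 : ∀ s ∈ Ioo 0 t, 0 ≤ r s)
    (hle : ∀ s ∈ Ioo 0 t, caputo α w s + lam * w s ≤ r s) :
    ENNReal.ofReal (w t) ≤ caputoResolventENN α lam r t := by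
  -- The positive part of the left-hand side is the smallest admissible majorant. It is measurable
  -- whatever `r` is, and replaces `r`.
  set G : ℝ → ℝ := fun s => max (caputo α w s + lam * w s) 0 with hGdef
  have hKpos : ∀ {x}, 0 < x → 0 < resolventKernel α lam x := resolventKernel_pos hα0 hα1 lam
  have hKm := measurable_resolventKernel hα0 hα1 lam
  have hGm : AEStronglyMeasurable G (volume.restrict (Ioo 0 t)) :=
    ((aestronglyMeasurable_caputo hα0 hα1 hw hw0 ht).add
      (hw.integrableOn.aestronglyMeasurable.const_mul lam)).sup aestronglyMeasurable_const
  have hKGm : AEStronglyMeasurable (fun s => resolventKernel α lam (t - s) * G s)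
      (volume.restrict (Ioo 0 t)) :=
    (Measurable.aestronglyMeasurable (by fun_prop)).mul hGm
  have hKG0 : 0 ≤ᵐ[volume.restrict (Ioo 0 t)] fun s => resolventKernel α lam (t - s) * G s := by
    filter_upwards [ae_restrict_mem measurableSet_Ioo] with s hs
    exact mul_nonneg (hKpos (sub_pos.2 hs.2)).le (le_max_right _ _)
  have hmono : ∫⁻ s in Ioo 0 t, ENNReal.ofReal (resolventKernel α lam (t - s) * G s)
      ≤ caputoResolventENN α lam r t := by
    refine setLIntegral_mono' measurableSet_Ioo fun s hs => ENNReal.ofReal_le_ofReal ?_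
    exact mul_le_mul_of_nonneg_left (max_le (hle s hs) (hr0 s hs)) (hKpos (sub_pos.2 hs.2)).le
  refine le_trans ?_ hmono
  by_cases hfin : ∫⁻ s in Ioo 0 t, ENNReal.ofReal (resolventKernel α lam (t - s) * G s) = ⊤
  · rw [hfin]
    exact le_top
  have hG := (lintegral_ofReal_ne_top_iff_integrable hKGm hKG0).1 hfin
  rw [← ofReal_integral_eq_lintegral_ofReal hG hKG0]
  exact ENNReal.ofReal_le_ofReal (le_integral_resolventKernel_mul hα0 hα1 lam hw hw0 ht
    (fun s _ => le_max_right _ _) hG fun s _ => le_max_left _ _)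

end Comparison

/-! ### From the Sobolev regularity in time to Lipschitz bounds. -/

theorem ae_norm_le_of_memLp_top {X E : Type*} [MeasurableSpace X] [NormedAddCommGroup E]
    {μ : Measure X} {g : X → E} (h : MemLp g ∞ μ) : ∃ M : ℝ, ∀ᵐ x ∂μ, ‖g x‖ ≤ M := by
  refine ⟨(eLpNorm g ∞ μ).toReal, ?_⟩
  filter_upwards [ae_le_eLpNormEssSup (f := g) (μ := μ)] with s hs
  rw [← eLpNorm_exponent_top] at hs
  rw [← toReal_enorm]
  exact ENNReal.toReal_mono h.2.ne hs

theorem TimeRegular.locLipschitz {X : Type*} [NormedAddCommGroup X] [NormedSpace ℝ X] {T t : ℝ}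
    {v : ℝ → X} (h : TimeRegular T v) (ht : t ∈ Ioc 0 T) : LocLipschitz t v where
  integrableOn := (h (t / 2) t (by linarith [ht.1]) (by linarith [ht.1]) ht.2).1.integrable le_top
  bounded := ae_norm_le_of_memLp_top
    (h (t / 2) t (by linarith [ht.1]) (by linarith [ht.1]) ht.2).1
  lipschitz ε hε := by
    obtain ⟨-, g, hg, hvg⟩ := (h ε t hε.1 hε.2 ht.2).2
    obtain ⟨M, hM⟩ := ae_norm_le_of_memLp_top hg
    refine ⟨M, fun s hs r hr => ?_⟩
    rw [hvg s hs r hr]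
    refine intervalIntegral.norm_integral_le_of_norm_le_const_ae ?_
    have h2 : ∀ᵐ x, x ∈ Ioc ε t → ‖g x‖ ≤ M := by
      rw [← ae_restrict_iff' measurableSet_Ioc, Measure.restrict_congr_set Ioo_ae_eq_Ioc.symm]
      exact hM
    filter_upwards [h2] with x hx hxs
    refine hx ?_
    rw [← uIoc_of_le hε.2.le]
    rw [← uIcc_of_le hε.2.le] at hs hr
    exact uIoc_subset_uIoc_of_uIcc_subset_uIcc (uIcc_subset_uIcc hs hr) hxs

/-! ### The chain rule inequality in a Hilbert space. -/

section Hilbert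

variable {α t : ℝ}

theorem caputo_sub {X : Type*} [NormedAddCommGroup X] [NormedSpace ℝ X] (hα0 : 0 < α) (hα1 : α < 1)
    (ht : 0 < t) {v v' : ℝ → X} (hv : LocLipschitz t v) (hv' : LocLipschitz t v') :
    caputo α (fun s => v s - v' s) t = caputo α v t - caputo α v' t := by
  have h := intervalIntegral.integral_sub (hv.intervalIntegrable_caputo hα0 hα1 ht)
    (hv'.intervalIntegrable_caputo hα0 hα1 ht)
  simp only [← smul_sub] at h
  have e : ∀ s, v t - v' t - (v s - v' s) = v t - v s - (v' t - v' s) := fun s => by abel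
  simp only [caputo, e, h, ← smul_sub]
  congr 1
  rw [smul_sub]
  abel

variable {H : Type*} [NormedAddCommGroup H] [InnerProductSpace ℝ H] [CompleteSpace H]

/-- The fractional chain rule inequality `‖e‖ D^α ‖e‖ ≤ ⟪D^α e, e⟫`. -/
theorem norm_mul_caputo_norm_le (hα0 : 0 < α) (hα1 : α < 1) (ht : 0 < t) {e : ℝ → H}
    (he : LocLipschitz t e) :
    ‖e t‖ * caputo α (fun s => ‖e s‖) t ≤ inner ℝ (e t) (caputo α e t) := by
  have hG := (inv_pos.2 (Real.Gamma_pos_of_pos (by linarith : 0 < 1 - α))).le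
  have hI := he.intervalIntegrable_caputo hα0 hα1 ht
  have hIn := he.norm.intervalIntegrable_caputo hα0 hα1 ht
  have hcomm := ContinuousLinearMap.intervalIntegral_comp_comm (innerSL ℝ (e t)) hI
  have hII : IntervalIntegrable
      (fun s => (α * (t - s) ^ (-α - 1)) * inner ℝ (e t) (e t - e s)) volume 0 t := by
    have h1 := (innerSL ℝ (e t)).integrable_comp
      ((intervalIntegrable_iff_integrableOn_Ioo_of_le ht.le).1 hI)
    rw [intervalIntegrable_iff_integrableOn_Ioo_of_le ht.le]
    simpa [inner_smul_right, IntegrableOn] using h1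
  have hkey : ∀ s, ‖e t‖ * (‖e t‖ - ‖e s‖) ≤ inner ℝ (e t) (e t - e s) := by
    intro s
    rw [inner_sub_right, real_inner_self_eq_norm_sq]
    nlinarith [real_inner_le_norm (e t) (e s)]
  -- `hkey` is Cauchy–Schwarz for each increment. The Caputo derivative is a combination of
  -- increments `e t - e s` with nonnegative weights, so the inequality passes through it.
  simp only [innerSL_apply_apply, inner_smul_right] at hcomm
  simp only [caputo, inner_smul_right, inner_add_right, ← hcomm, smul_eq_mul]
  rw [mul_left_comm, mul_add, mul_left_comm ‖e t‖]
  refine mul_le_mul_of_nonneg_left (add_le_add ?_ ?_) hG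
  · exact mul_le_mul_of_nonneg_left (hkey 0) (Real.rpow_nonneg ht.le _)
  · rw [← intervalIntegral.integral_const_mul]
    refine intervalIntegral.integral_mono_on ht.le (hIn.const_mul _) hII fun s hs => ?_
    rw [mul_left_comm]
    exact mul_le_mul_of_nonneg_left (hkey s)
      (mul_nonneg hα0.le (Real.rpow_nonneg (by linarith [hs.2]) _))

/-- At a minimum every increment `w t - w s` is nonpositive. This covers the times when `e t = 0`,
where the chain rule inequality cannot be divided by `‖e t‖`. -/
theorem caputo_nonpos_of_eq_zero (hα0 : 0 < α) (hα1 : α < 1) (ht : 0 < t) {w : ℝ → ℝ}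
    (hw : ∀ s, 0 ≤ w s) (hwt : w t = 0) : caputo α w t ≤ 0 := by
  have hG := (inv_pos.2 (Real.Gamma_pos_of_pos (by linarith : 0 < 1 - α))).le
  simp only [caputo, hwt, zero_sub, smul_eq_mul, mul_neg, intervalIntegral.integral_neg]
  have h1 : 0 ≤ ∫ s in (0 : ℝ)..t, α * (t - s) ^ (-α - 1) * w s :=
    intervalIntegral.integral_nonneg ht.le fun s hs =>
      mul_nonneg (mul_nonneg hα0.le (Real.rpow_nonneg (by linarith [hs.2]) _)) (hw s)
  have h2 := mul_nonneg (Real.rpow_nonneg ht.le (-α)) (hw 0)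
  refine mul_nonpos_of_nonneg_of_nonpos hG (by linarith)

theorem caputo_norm_add_le (hα0 : 0 < α) (hα1 : α < 1) (ht : 0 < t) {e : ℝ → H}
    (he : LocLipschitz t e) {lam ρ : ℝ} (hρ : 0 ≤ ρ)
    (h : inner ℝ (e t) (caputo α e t) + lam * ‖e t‖ ^ 2 ≤ ρ * ‖e t‖) :
    caputo α (fun s => ‖e s‖) t + lam * ‖e t‖ ≤ ρ := by
  rcases (norm_nonneg (e t)).eq_or_lt with h0 | h0
  · have := caputo_nonpos_of_eq_zero hα0 hα1 ht (w := fun s => ‖e s‖) (fun s => norm_nonneg _)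
      h0.symm
    rw [← h0]
    linarith
  · have h1 := norm_mul_caputo_norm_le hα0 hα1 ht he
    refine le_of_mul_le_mul_left ?_ h0
    nlinarith

end Hilbert

/-! ### The weak form and the energy identity. -/

section Energy

variable {d : ℕ} {Ω : Set (Rd d)}

theorem IsTest.sub {φ ψ : Rd d → ℝ} (hφ : IsTest Ω φ) (hψ : IsTest Ω ψ) :
    IsTest Ω fun x => φ x - ψ x :=
  ⟨hφ.1.sub hψ.1, hφ.2.1.sub hψ.2.1, (tsupport_sub φ ψ).trans (union_subset hφ.2.2 hψ.2.2)⟩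

theorem IsTest.gradient_sub {φ ψ : Rd d → ℝ} (hφ : IsTest Ω φ) (hψ : IsTest Ω ψ) (x : Rd d) :
    gradient (fun x => φ x - ψ x) x = gradient φ x - gradient ψ x := by
  simp only [gradient]
  rw [fderiv_fun_sub (hφ.1.differentiable (by simp) x) (hψ.1.differentiable (by simp) x), map_sub]

theorem H01.sub_mem {z z' : L2 Ω × L2Vec Ω} (hz : z ∈ H01 Ω) (hz' : z' ∈ H01 Ω) :
    z - z' ∈ H01 Ω := by
  refine map_mem_closure₂ continuous_sub hz hz' ?_
  rintro a ⟨φ, hφ, ha1, ha2⟩ b ⟨ψ, hψ, hb1, hb2⟩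
  refine ⟨fun x => φ x - ψ x, hφ.sub hψ, ?_, ?_⟩
  · filter_upwards [Lp.coeFn_sub a.1 b.1, ha1, hb1] with x h1 h2 h3
    rw [Prod.fst_sub, h1, Pi.sub_apply, h2, h3]
  · filter_upwards [Lp.coeFn_sub a.2 b.2, ha2, hb2] with x h1 h2 h3
    rw [Prod.snd_sub, h1, Pi.sub_apply, h2, h3, hφ.gradient_sub hψ]

namespace EllipticOperator

variable (L : EllipticOperator Ω)

theorem memLp_flux (v : L2 Ω) (dv : L2Vec Ω) :
    MemLp (fun x => L.A x (dv x) + v x • L.p x) 2 (volume.restrict Ω) := by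
  obtain ⟨M, hM⟩ := ae_norm_le_of_memLp_top L.memLp_A
  obtain ⟨N, hN⟩ := ae_norm_le_of_memLp_top L.memLp_p
  have h1 : MemLp (fun x => L.A x (dv x)) 2 (volume.restrict Ω) := by
    refine (Lp.memLp dv).of_le_mul (c := M)
      ((ContinuousLinearMap.id ℝ (Rd d →L[ℝ] Rd d)).aestronglyMeasurable_comp₂
        L.memLp_A.aestronglyMeasurable (Lp.aestronglyMeasurable dv)) ?_
    filter_upwards [hM] with x hx
    exact (L.A x).le_of_opNorm_le hx _
  have h2 : MemLp (fun x => v x • L.p x) 2 (volume.restrict Ω) := by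
    refine (Lp.memLp v).of_le_mul (c := N)
      ((Lp.aestronglyMeasurable v).smul L.memLp_p.aestronglyMeasurable) ?_
    filter_upwards [hN] with x hx
    rw [norm_smul, mul_comm]
    gcongr
  exact h1.add h2

theorem memLp_source (v : L2 Ω) (dv : L2Vec Ω) :
    MemLp (fun x => inner ℝ (L.q x) (dv x) + L.c x * v x) 2 (volume.restrict Ω) := by
  obtain ⟨M, hM⟩ := ae_norm_le_of_memLp_top L.memLp_q
  obtain ⟨N, hN⟩ := ae_norm_le_of_memLp_top L.memLp_c
  have h1 : MemLp (fun x => (inner ℝ (L.q x) (dv x) : ℝ)) 2 (volume.restrict Ω) := by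
    refine (Lp.memLp dv).of_le_mul (c := M)
      (L.memLp_q.aestronglyMeasurable.inner (Lp.aestronglyMeasurable dv)) ?_
    filter_upwards [hM] with x hx
    refine (norm_inner_le_norm _ _).trans ?_
    gcongr
  have h2 : MemLp (fun x => L.c x * v x) 2 (volume.restrict Ω) := by
    refine (Lp.memLp v).of_le_mul (c := N)
      (L.memLp_c.aestronglyMeasurable.mul (Lp.aestronglyMeasurable v)) ?_
    filter_upwards [hN] with x hx
    rw [norm_mul]
    gcongr
  exact h1.add h2

/-- `A ∇v + v p` as an element of `L_2(Ω)ᵈ`. -/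
noncomputable def flux (v : L2 Ω) (dv : L2Vec Ω) : L2Vec Ω := (L.memLp_flux v dv).toLp

/-- `q · ∇v + c v` as an element of `L_2(Ω)`. -/
noncomputable def source (v : L2 Ω) (dv : L2Vec Ω) : L2 Ω := (L.memLp_source v dv).toLp

/-- Written with inner products, the form is visibly continuous in the test pair `(w, dw)`, as
needed to pass from test functions to their closure. -/
theorem pairing_eq_inner (v : L2 Ω) (dv : L2Vec Ω) (w : L2 Ω) (dw : L2Vec Ω) {φ : Rd d → ℝ}
    {dφ : Rd d → Rd d} (hw : w =ᵐ[volume.restrict Ω] φ) (hdw : dw =ᵐ[volume.restrict Ω] dφ) :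
    L.pairing v dv φ dφ = inner ℝ (L.flux v dv) dw + inner ℝ (L.source v dv) w := by
  rw [L2.inner_def, L2.inner_def, ← integral_add (L2.integrable_inner _ _)
    (L2.integrable_inner _ _)]
  refine integral_congr_ae ?_
  filter_upwards [(L.memLp_flux v dv).coeFn_toLp, (L.memLp_source v dv).coeFn_toLp, hw, hdw]
    with x h1 h2 h3 h4
  rw [flux, source, h1, h2, h3, h4, inner_add_left, real_inner_smul_left]
  simp only [RCLike.inner_apply, conj_trivial]
  ring

theorem flux_sub (v v' : L2 Ω) (dv dv' : L2Vec Ω) :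
    L.flux (v - v') (dv - dv') = L.flux v dv - L.flux v' dv' := by
  apply Lp.ext
  filter_upwards [(L.memLp_flux v dv).coeFn_toLp, (L.memLp_flux v' dv').coeFn_toLp,
    (L.memLp_flux (v - v') (dv - dv')).coeFn_toLp, Lp.coeFn_sub v v', Lp.coeFn_sub dv dv',
    Lp.coeFn_sub (L.flux v dv) (L.flux v' dv')] with x h1 h2 h3 h4 h5 h6
  rw [h6, Pi.sub_apply, flux, flux, flux, h1, h2, h3, h4, h5, Pi.sub_apply, Pi.sub_apply, map_sub,
    sub_smul]
  abel

theorem source_sub (v v' : L2 Ω) (dv dv' : L2Vec Ω) :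
    L.source (v - v') (dv - dv') = L.source v dv - L.source v' dv' := by
  apply Lp.ext
  filter_upwards [(L.memLp_source v dv).coeFn_toLp, (L.memLp_source v' dv').coeFn_toLp,
    (L.memLp_source (v - v') (dv - dv')).coeFn_toLp, Lp.coeFn_sub v v', Lp.coeFn_sub dv dv',
    Lp.coeFn_sub (L.source v dv) (L.source v' dv')] with x h1 h2 h3 h4 h5 h6
  rw [h6, Pi.sub_apply, source, source, source, h1, h2, h3, h4, h5, Pi.sub_apply, Pi.sub_apply,
    inner_sub_right]
  ring

end EllipticOperator

theorem integral_mul_eq_inner (v w : L2 Ω) {φ : Rd d → ℝ} (hw : w =ᵐ[volume.restrict Ω] φ) :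
    ∫ x in Ω, v x * φ x = inner ℝ v w := by
  rw [L2.inner_def]
  refine integral_congr_ae ?_
  filter_upwards [hw] with x h
  simp only [h, RCLike.inner_apply, conj_trivial]
  ring

/-- The energy identity for the difference of two functions with residuals `R` and `R'` for the same
right-hand side. -/
theorem HasResidualAt.energy_identity {L : EllipticOperator Ω} {α t : ℝ} {f : Rd d → ℝ → ℝ}
    {v v' : ℝ → L2 Ω} {R R' : L2 Ω} (h : HasResidualAt L α f v t R)
    (h' : HasResidualAt L α f v' t R') :
    ∃ de : L2Vec Ω, (v t - v' t, de) ∈ H01 Ω ∧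
      inner ℝ (caputo α v t - caputo α v' t) (v t - v' t)
        + L.pairing ((v t - v' t : L2 Ω) : Rd d → ℝ) de ((v t - v' t : L2 Ω) : Rd d → ℝ) de
        = inner ℝ (R - R') (v t - v' t) := by
  obtain ⟨dv, hdv, hv⟩ := h
  obtain ⟨dv', hdv', hv'⟩ := h'
  have hmem : (v t - v' t, dv - dv') ∈ H01 Ω := H01.sub_mem hdv hdv'
  refine ⟨dv - dv', hmem, ?_⟩
  rw [L.pairing_eq_inner _ _ _ _ EventuallyEq.rfl EventuallyEq.rfl]
  -- The tested identity is a closed condition on the pair `z`. It holds for test functions, where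
  -- the two `f` terms cancel, hence on `H01 Ω`, in particular for the difference itself.
  have hcl : IsClosed {z : L2 Ω × L2Vec Ω | inner ℝ (caputo α v t - caputo α v' t) z.1
      + (inner ℝ (L.flux (v t - v' t) (dv - dv')) z.2
        + inner ℝ (L.source (v t - v' t) (dv - dv')) z.1) = inner ℝ (R - R') z.1} :=
    isClosed_eq (by fun_prop) (by fun_prop)
  refine closure_minimal ?_ hcl hmem
  rintro z ⟨φ, hφ, hz1, hz2⟩
  have h1 := hv φ hφ
  have h2 := hv' φ hφ
  rw [integral_mul_eq_inner _ _ hz1, integral_mul_eq_inner _ _ hz1,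
    L.pairing_eq_inner _ _ _ _ hz1 hz2] at h1 h2
  simp only [mem_ofPred_eq, L.flux_sub, L.source_sub, inner_sub_left]
  linarith

end Energy

/-! ### The error bound. -/

theorem theorem1 {d : ℕ} {Ω : Set (Rd d)} (hΩ : IsOpen Ω)
    {α T lam : ℝ} (hα0 : 0 < α) (hα1 : α < 1)
    (L : EllipticOperator Ω)
    (hL : ∀ v : L2 Ω, ∀ dv : L2Vec Ω, (v, dv) ∈ H01 Ω → lam * ‖v‖ ^ 2 ≤ L.pairing v dv v dv)
    (f : Rd d → ℝ → ℝ) (hf : ∀ t ∈ Ioc 0 T, LocallyIntegrableOn (fun x => f x t) Ω)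
    (u0 : L2 Ω) (u uh R : ℝ → L2 Ω)
    (hu : IsSolution L α T f u0 u) (hu_reg : TimeRegular T u)
    (huh_reg : TimeRegular T uh) (huh0 : uh 0 = u0)
    (hR : ∀ t ∈ Ioc 0 T, HasResidualAt L α f uh t (R t)) :
    ∀ t ∈ Ioc 0 T,
      ENNReal.ofReal ‖uh t - u t‖ ≤ caputoResolventENN α lam (fun s => ‖R s‖) t ∧
      (IntervalIntegrable (fun s => resolventKernel α lam (t - s) * ‖R s‖) volume 0 t →
        ‖uh t - u t‖ ≤ caputoResolvent α lam (fun s => ‖R s‖) t) := by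
  intro t ht
  have hreg : ∀ s ∈ Ioc 0 T, LocLipschitz s fun s => uh s - u s := fun s hs =>
    (huh_reg.locLipschitz hs).sub (hu_reg.locLipschitz hs)
  have hw0 : ‖uh 0 - u 0‖ = 0 := by rw [huh0, hu.1, sub_self, norm_zero]
  have hle : ∀ s ∈ Ioo 0 t,
      caputo α (fun s => ‖uh s - u s‖) s + lam * ‖uh s - u s‖ ≤ ‖R s‖ := by
    intro s hs
    have hsT : s ∈ Ioc 0 T := ⟨hs.1, hs.2.le.trans ht.2⟩
    -- The exact solution has residual `0`, so the energy identity has `R s - 0` on the right.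
    obtain ⟨de, hde, hen⟩ := (hR s hsT).energy_identity (hu.2 s hsT)
    refine caputo_norm_add_le hα0 hα1 hs.1 (hreg s hsT) (norm_nonneg _) ?_
    rw [caputo_sub hα0 hα1 hs.1 (huh_reg.locLipschitz hsT) (hu_reg.locLipschitz hsT),
      real_inner_comm]
    have h1 := hL _ _ hde
    have h2 := real_inner_le_norm (R s - 0) (uh s - u s)
    rw [← hen, sub_zero] at h2
    linarith
  have hENN : ENNReal.ofReal ‖uh t - u t‖ ≤ caputoResolventENN α lam (fun s => ‖R s‖) t :=
    le_caputoResolventENN hα0 hα1 lam (hreg t ht).norm hw0 ht.1 (fun s _ => norm_nonneg _) hle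
  refine ⟨hENN, fun hint => ?_⟩
  rw [intervalIntegrable_iff_integrableOn_Ioo_of_le ht.1.le] at hint
  exact le_integral_resolventKernel_mul hα0 hα1 lam (hreg t ht).norm hw0 ht.1
    (fun s _ => norm_nonneg _) hint hle |>.trans_eq (by
      rw [caputoResolvent, intervalIntegral.integral_of_le ht.1.le, integral_Ioc_eq_integral_Ioo])
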